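/- Let $\mathbb K$ be $\mathbb R$ or $\mathbb C$. For a normed space $X$ over $\mathbb K$ let $B_{X^*}$ be the closed unit ball of its dual. The dual $X^*$ has the \emph{weak* uniform Kadec--Klee property} if for every $\varepsilon>0$ there is $\delta>0$ such that, whenever $(x_n^*)$ is a sequence in $B_{X^*}$ that converges weak* to $x^*\in X^*$ and $\inf\{\|x_n^*-x_m^*\| : m\neq n\}>\varepsilon$, one has $\|x^*\|<1-\delta$. The space $X$ has the \emph{weak fixed point property for nonexpansive mappings} if, for every nonempty, weakly compact, convex set $C\subseteq X$, every map $T:C\to C$ with $\|Tx-Ty\|\le\|x-y\|$ for all $x,y\in C$ has a fixed point. (a) Let $X$ be a Banach space over $\mathbb K$ such that $B_{X^*}$ is weak* sequentially compact. If $X^*$ has the weak* uniform Kadec--Klee property, then $X$ has the weak fixed point property for nonexpansive mappings. (b) Consequently, the following spaces have the weak fixed point property for nonexpansive mappings: the space $c_0$ over $\mathbb K$ with the supremum norm; the quotient $C(\mathbb T)/A_0$ with the quotient norm, where $C(\mathbb T)$ is the space of continuous complex functions on the unit circle with the supremum norm and $A_0=\{f\in C(\mathbb T): \hat f(n)=0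 \text{ for all } n\le 0\}$ is the space of boundary values of disc algebra functions vanishing at $0$ (this quotient is the predual of the Hardy space $H^1$); and the space of compact operators on any Hilbert space over $\mathbb K$, with the operator norm. -/

import Mathlib

open Filter Topology
open scoped ZeroAtInfty

noncomputable section

/-- The closed unit ball of the dual of `X` is sequentially compact for the weak* topology. -/
def WeakStarSeqCompactDualBall (𝕜 X : Type*) [RCLike 𝕜] [NormedAddCommGroup X]
    [NormedSpace 𝕜 X] : Prop :=
  IsSeqCompact (WeakDual.toStrongDual ⁻¹' Metric.closedBall (0 : StrongDual 𝕜 X) 1)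

/-- The separation constant `inf {‖x n - x m‖ : m ≠ n}` of a sequence. -/
def sepConst {E : Type*} [NormedAddCommGroup E] (x : ℕ → E) : ℝ :=
  sInf {r : ℝ | ∃ m n : ℕ, m ≠ n ∧ r = ‖x n - x m‖}

/-- The dual of `X` has the weak* uniform Kadec-Klee property. -/
def DualHasWeakStarUKK (𝕜 X : Type*) [RCLike 𝕜] [NormedAddCommGroup X]
    [NormedSpace 𝕜 X] : Prop :=
  ∀ ε : ℝ, 0 < ε → ∃ δ : ℝ, 0 < δ ∧
    ∀ (x : ℕ → StrongDual 𝕜 X) (x' : StrongDual 𝕜 X),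
      (∀ n, ‖x n‖ ≤ 1) →
      Tendsto (fun n => StrongDual.toWeakDual (x n)) atTop (𝓝 (StrongDual.toWeakDual x')) →
      ε < sepConst x →
      ‖x'‖ < 1 - δ

/-- `X` has the weak fixed point property for nonexpansive mappings: every nonexpansive self-map
of a nonempty, weakly compact, convex subset of `X` has a fixed point. Convexity is with respect to
the underlying real structure of `X`. -/
def HasWeakFPP (𝕜 X : Type*) [RCLike 𝕜] [NormedAddCommGroup X] [NormedSpace 𝕜 X] : Prop :=
  letI : NormedSpace ℝ X := NormedSpace.restrictScalars ℝ 𝕜 X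
  ∀ C : Set X, C.Nonempty → IsCompact (toWeakSpace 𝕜 X '' C) → Convex ℝ C →
    ∀ T : C → C, LipschitzWith 1 T → ∃ x : C, T x = x

/-- The unit circle, as `ℝ / 2πℤ`. -/
abbrev UCircle : Type := AddCircle (2 * Real.pi)

instance factTwoPiPos : Fact (0 < 2 * Real.pi) := ⟨Real.two_pi_pos⟩

/-- The subspace `A₀` of `C(𝕋)`: the boundary values of the disc algebra functions that vanish
at the origin, that is, the continuous functions on the circle whose Fourier
coefficients of index `≤ 0` are all zero. -/
def discAlgebraZero : Submodule ℂ C(UCircle, ℂ) where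
  carrier := {f | ∀ n : ℤ, n ≤ 0 → fourierCoeff (f : UCircle → ℂ) n = 0}
  zero_mem' := by
    intro n _
    simp [fourierCoeff]
  add_mem' := by
    intro f g hf hg n hn
    have hi : ∀ f : C(UCircle, ℂ), MeasureTheory.Integrable (f : UCircle → ℂ)
        AddCircle.haarAddCircle := fun f =>
      f.continuous.integrable_of_hasCompactSupport (HasCompactSupport.of_compactSpace _)
    rw [ContinuousMap.coe_add, fourierCoeff.add (hi f) (hi g), Pi.add_apply, hf n hn, hg n hn,
      add_zero]
  smul_mem' := by
    intro c f hf n hn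
    rw [ContinuousMap.coe_smul, fourierCoeff.const_smul, hf n hn, smul_zero]

instance isClosed_discAlgebraZero : IsClosed (discAlgebraZero : Set C(UCircle, ℂ)) := by
  have h : (discAlgebraZero : Set C(UCircle, ℂ)) =
      ⋂ n : ℤ, ⋂ _ : n ≤ 0, {f : C(UCircle, ℂ) | fourierCoeff (f : UCircle → ℂ) n = 0} := by
    ext f
    simp [discAlgebraZero]
  rw [h]
  refine isClosed_iInter fun n => isClosed_iInter fun _ => isClosed_eq ?_ continuous_const
  have hc : Continuous fun f : C(UCircle, ℂ) =>
      fourierBasis.repr (ContinuousMap.toLp 2 AddCircle.haarAddCircle ℂ f) n :=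
    ((lp.evalCLM ℂ (fun _ : ℤ => ℂ) 2 n).continuous.comp fourierBasis.repr.continuous).comp
      (ContinuousMap.toLp 2 AddCircle.haarAddCircle ℂ).continuous
  refine hc.congr fun f => ?_
  rw [fourierBasis_repr, fourierCoeff_toLp]

end

/-! Everything passes through `WeakNullSumBound`, a uniform form of García-Falset's condition R(X) <
2. It implies the weak fixed point property, it follows from the weak* uniform Kadec–Klee property
by a duality argument, and it is inherited by isometrically embedded subspaces.

For `WeakNullSumBound.hasWeakFPP`, take a minimal invariant weakly compact convex set of diameter d
> 0 and approximate fixed points `x n` in it with weak limit p. Solving w = (1 - t) g w + t (x n +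
p)/2 gives new approximate fixed points w with ‖w - p‖ ≤ d(1 - δ/2). By the Goebel–Karlovitz lemma
the diameter is then smaller than d, a contradiction. Weak limits are taken along an ultrafilter, so
no weakly convergent subsequences are needed.

The examples in (b) satisfy `WeakNullSumBound` directly. In c₀ the supports separate up to small
errors; for compact operators a Hilbert space estimate gives squared norms asymptotically at most 3,
which is less than (7/4)². The quotient C(𝕋)/A₀ embeds isometrically into the compact operators on
L²(𝕋) by F ↦ Hankel operator of F, which is Nehari's theorem (`norm_hankel_eq`). Its hard half uses
that analytic polynomials are uniform limits of products u v with |u| = |v| on the circle, so that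
∫|uv| = ‖u‖₂‖v‖₂, together with Fejér means. -/

/-- A uniform form of the condition `R(X) < 2`: the sum of a weakly null sequence in the unit ball
and a vector of the unit ball cannot have norm uniformly close to `2`. Weak nullity is taken along
a fixed free ultrafilter. -/
def WeakNullSumBound (𝕜 X : Type*) [RCLike 𝕜] [NormedAddCommGroup X] [NormedSpace 𝕜 X] : Prop :=
  ∃ δ : ℝ, 0 < δ ∧ ∀ (u : ℕ → X) (y : X), (∀ n, ‖u n‖ ≤ 1) → ‖y‖ ≤ 1 →
    (∀ f : StrongDual 𝕜 X, Tendsto (fun n => f (u n)) (hyperfilter ℕ) (𝓝 0)) →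
    ∃ n, ‖u n + y‖ ≤ 2 - δ

/-! ### From the weak* uniform Kadec–Klee property to the bound on sums. -/

section UKK

variable {𝕜 X : Type*} [RCLike 𝕜] [NormedAddCommGroup X] [NormedSpace 𝕜 X]

theorem le_sepConst {x : ℕ → X} {r : ℝ} (h : ∀ m n, m < n → r ≤ ‖x n - x m‖) :
    r ≤ sepConst x := by
  refine le_csInf ⟨_, 0, 1, by norm_num, rfl⟩ ?_
  rintro _ ⟨m, n, hmn, rfl⟩
  rcases lt_or_gt_of_ne hmn with h' | h'
  · exact h m n h'
  · rw [norm_sub_rev]; exact h n m h'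

/-- If all ‖u n + y‖ are close to 2, norming functionals f n are almost norming for both `u n` and
y. Weak nullity of u makes a selection of the f n separated, yet a weak* limit of them still has
norm at least 1 - δ because of its value at y. -/
theorem weakNullSumBound_of_dualHasWeakStarUKK (hc : WeakStarSeqCompactDualBall 𝕜 X)
    (hk : DualHasWeakStarUKK 𝕜 X) : WeakNullSumBound 𝕜 X := by
  obtain ⟨δ₀, hδ₀, H⟩ := hk (1 / 4) (by norm_num)
  refine ⟨min δ₀ (1 / 4), by positivity, fun u y hu hy hw => ?_⟩
  by_contra! hcon
  set δ := min δ₀ (1 / 4) with hδ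
  have hδ1 : δ ≤ δ₀ := min_le_left _ _
  have hδ2 : δ ≤ 1 / 4 := min_le_right _ _
  choose f hf1 hf2 using fun n => exists_dual_vector'' 𝕜 (u n + y)
  have hsum : ∀ n, 2 - δ < ‖f n (u n)‖ + ‖f n y‖ := fun n => by
    have h1 : ‖f n (u n + y)‖ = ‖u n + y‖ := by rw [hf2]; simp
    have h2 := norm_add_le (f n (u n)) (f n y)
    rw [← map_add, h1] at h2
    exact (hcon n).trans_le h2
  have hb : ∀ (g : StrongDual 𝕜 X) (z : X), ‖g‖ ≤ 1 → ‖z‖ ≤ 1 → ‖g z‖ ≤ 1 := fun g z hg hz =>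
    (g.le_opNorm z).trans (mul_le_one₀ hg (norm_nonneg _) hz)
  -- Each new index is chosen so that all earlier functionals are small on its vector; φ need not be
  -- increasing.
  obtain ⟨φ, -, hφ⟩ := exists_seq_of_forall_finset_exists (fun _ : ℕ => True)
    (fun a b => ‖f a (u b)‖ ≤ 1 / 4) (fun s _ => by
      have : ∀ᶠ n in (hyperfilter ℕ : Filter ℕ), ∀ a ∈ s, ‖f a (u n)‖ ≤ 1 / 4 := by
        rw [Finset.eventually_all]
        intro a _
        have := (hw (f a)).norm
        rw [norm_zero] at this
        exact this.eventually_le_const (by norm_num)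
      obtain ⟨n, hn⟩ := this.exists
      exact ⟨n, trivial, hn⟩)
  obtain ⟨g, -, ψ, hψ, hg⟩ := hc (x := fun k => StrongDual.toWeakDual (f (φ k)))
    (fun k => by simpa using hf1 (φ k))
  have h1 := H (fun k => f (φ (ψ k))) (WeakDual.toStrongDual g) (fun k => hf1 _) hg ?_
  · have hl : Tendsto (fun k => ‖f (φ (ψ k)) y‖) atTop (𝓝 ‖g y‖) :=
      (((WeakDual.eval_continuous y).tendsto g).comp hg).norm
    have h2 : 1 - δ ≤ ‖g y‖ := ge_of_tendsto' hl fun k => by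
      linarith [hsum (φ (ψ k)), hb _ _ (hf1 (φ (ψ k))) (hu (φ (ψ k)))]
    have h3 : ‖g y‖ ≤ ‖WeakDual.toStrongDual g‖ * ‖y‖ := (WeakDual.toStrongDual g).le_opNorm y
    nlinarith [norm_nonneg (WeakDual.toStrongDual g)]
  -- For a < b, the later functional exceeds 1 - δ ≥ 3/4 in modulus on its own vector and the
  -- earlier one is at most 1/4 there, so they are at least 1/2 apart.
  · refine lt_of_lt_of_le (by norm_num : (1 / 4 : ℝ) < 1 / 2) (le_sepConst fun a b hab => ?_)
    have h2 := hφ _ _ (hψ hab)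
    have h3 := hsum (φ (ψ b))
    have h4 := hb _ _ (hf1 (φ (ψ b))) hy
    have h5 := (f (φ (ψ b)) - f (φ (ψ a))).le_opNorm (u (φ (ψ b)))
    have h6 := norm_sub_norm_le (f (φ (ψ b)) (u (φ (ψ b)))) (f (φ (ψ a)) (u (φ (ψ b))))
    rw [sub_apply] at h5
    nlinarith [hu (φ (ψ b)), norm_nonneg (f (φ (ψ b)) - f (φ (ψ a)))]

theorem WeakNullSumBound.of_linearIsometry {Y : Type*} [NormedAddCommGroup Y] [NormedSpace 𝕜 Y]
    (hY : WeakNullSumBound 𝕜 Y) (J : X →ₗᵢ[𝕜] Y) : WeakNullSumBound 𝕜 X := by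
  obtain ⟨δ, hδ, H⟩ := hY
  refine ⟨δ, hδ, fun u y hu hy hw => ?_⟩
  obtain ⟨n, hn⟩ := H (fun n => J (u n)) (J y) (fun n => by simpa using hu n) (by simpa using hy)
    (fun f => hw (f.comp J.toContinuousLinearMap))
  exact ⟨n, by rwa [← map_add, J.norm_map] at hn⟩

end UKK

/-! ### Weak limits along ultrafilters, boundedness and Mazur's theorem. -/

section WeakLimits

variable {𝕜 X : Type*} [RCLike 𝕜] [NormedAddCommGroup X] [NormedSpace 𝕜 X]

theorem norm_le_of_weak_tendsto {ι : Type*} {l : Filter ι} [l.NeBot] {w : ι → X} {y : X} {r : ℝ}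
    (h : ∀ f : StrongDual 𝕜 X, Tendsto (fun n => f (w n)) l (𝓝 (f y)))
    (hr : ∀ᶠ n in l, ‖w n‖ ≤ r) : ‖y‖ ≤ r := by
  obtain ⟨f, hf1, hf2⟩ := exists_dual_vector'' 𝕜 y
  have h1 : ‖f y‖ = ‖y‖ := by rw [hf2]; simp
  rw [← h1]
  refine le_of_tendsto (h f).norm (hr.mono fun n hn => ?_)
  calc ‖f (w n)‖ ≤ ‖f‖ * ‖w n‖ := f.le_opNorm _
    _ ≤ 1 * ‖w n‖ := by gcongr
    _ ≤ r := by rwa [one_mul]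

theorem exists_weak_ultrafilter_limit {C : Set X} (hC : IsCompact (toWeakSpace 𝕜 X '' C))
    {ι : Type*} (U : Ultrafilter ι) {w : ι → X} (hw : ∀ n, w n ∈ C) :
    ∃ y ∈ C, ∀ f : StrongDual 𝕜 X, Tendsto (fun n => f (w n)) U (𝓝 (f y)) := by
  obtain ⟨_, ⟨y, hy, rfl⟩, hle⟩ := hC.ultrafilter_le_nhds
    (U.map fun n => toWeakSpace 𝕜 X (w n))
    (by
      rw [Ultrafilter.coe_map, le_principal_iff, mem_map]
      exact univ_mem' fun n => ⟨w n, hw n, rfl⟩)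
  refine ⟨y, hy, fun f => ?_⟩
  have hf : Continuous fun z : WeakSpace 𝕜 X => f ((toWeakSpace 𝕜 X).symm z) :=
    WeakBilin.eval_continuous (topDualPairing 𝕜 X).flip f
  exact (hf.tendsto (toWeakSpace 𝕜 X y)).comp hle

theorem exists_norm_le_of_isCompact_weak {C : Set X} (hC : IsCompact (toWeakSpace 𝕜 X '' C)) :
    ∃ M : ℝ, ∀ x ∈ C, ‖x‖ ≤ M := by
  obtain ⟨M, hM⟩ := banach_steinhaus (𝕜 := 𝕜) (𝕜₂ := 𝕜)
    (g := fun x : C => NormedSpace.inclusionInDoubleDual 𝕜 X x) (fun f => by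
      have hf : Continuous fun z : WeakSpace 𝕜 X => f ((toWeakSpace 𝕜 X).symm z) :=
        WeakBilin.eval_continuous (topDualPairing 𝕜 X).flip f
      obtain ⟨M, hM⟩ := hC.exists_bound_of_continuousOn hf.continuousOn
      exact ⟨M, fun x => hM _ ⟨x, x.2, rfl⟩⟩)
  refine ⟨M, fun x hx => ?_⟩
  rw [← (NormedSpace.inclusionInDoubleDualLi 𝕜 (E := X)).norm_map x]
  exact hM ⟨x, hx⟩

variable [NormedSpace ℝ X] [IsScalarTower ℝ 𝕜 X]

theorem isClosed_image_toWeakSpace {D : Set X} (hc : IsClosed D) (hv : Convex ℝ D) :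
    IsClosed (toWeakSpace 𝕜 X '' D) := by
  rw [← closure_eq_iff_isClosed, ← hv.toWeakSpace_closure 𝕜, hc.closure_eq]

end WeakLimits

/-! ### Minimal invariant sets and the Goebel–Karlovitz lemma. -/

/-- A nonempty closed convex set that is mapped into itself by `g`. -/
structure IsInvariantConvex {X : Type*} [NormedAddCommGroup X] [NormedSpace ℝ X] (g : X → X)
    (D : Set X) : Prop where
  nonempty : D.Nonempty
  isClosed : IsClosed D
  convex : Convex ℝ D
  mapsTo : Set.MapsTo g D D

section Minimal

variable {X : Type*} [NormedAddCommGroup X] [NormedSpace ℝ X] {g : X → X} {D : Set X}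

/-- Every invariant convex subset of a weakly compact set contains a minimal one. -/
theorem exists_minimal_isInvariantConvex (𝕜 : Type*) [RCLike 𝕜] [NormedSpace 𝕜 X]
    [IsScalarTower ℝ 𝕜 X] {C : Set X} (hC : IsCompact (toWeakSpace 𝕜 X '' C))
    (h : IsInvariantConvex g C) :
    ∃ D ⊆ C, Minimal (IsInvariantConvex g) D := by
  obtain ⟨D, hDC, hD⟩ := zorn_superset_nonempty {D | IsInvariantConvex g D ∧ D ⊆ C}
    (fun c hc hchain hne => by
      have hcl : ∀ D ∈ c, IsClosed (toWeakSpace 𝕜 X '' D) := fun D hD =>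
        isClosed_image_toWeakSpace (hc hD).1.isClosed (hc hD).1.convex
      have hcne : (⋂₀ c).Nonempty := by
        have : Nonempty c := hne.to_subtype
        have := IsCompact.nonempty_iInter_of_directed_nonempty_isCompact_isClosed
          (fun D : c => toWeakSpace 𝕜 X '' (D : Set X))
          (by
            intro A B
            rcases hchain.total A.2 B.2 with hAB | hAB
            · exact ⟨A, subset_rfl, Set.image_mono hAB⟩
            · exact ⟨B, Set.image_mono hAB, subset_rfl⟩)
          (fun A => (hc A.2).1.nonempty.image _)
          (fun A => hC.of_isClosed_subset (hcl _ A.2) (Set.image_mono (hc A.2).2))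
          (fun A => hcl _ A.2)
        obtain ⟨z, hz⟩ := this
        refine ⟨(toWeakSpace 𝕜 X).symm z, fun A hA => ?_⟩
        obtain ⟨a, ha, rfl⟩ := Set.mem_iInter.1 hz ⟨A, hA⟩
        simpa using ha
      refine ⟨⋂₀ c, ⟨⟨hcne, isClosed_sInter fun A hA => (hc hA).1.isClosed,
        convex_sInter fun A hA => (hc hA).1.convex, fun x hx A hA => (hc hA).1.mapsTo (hx A hA)⟩,
        ?_⟩, fun A hA => Set.sInter_subset_of_mem hA⟩
      obtain ⟨A, hA⟩ := hne
      exact (Set.sInter_subset_of_mem hA).trans (hc hA).2)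
    C ⟨h, subset_rfl⟩
  exact ⟨D, hDC, hD.prop.1, fun E hE hED => hD.le_of_le ⟨hE, hED.trans hDC⟩ hED⟩

theorem exists_eq_lineMap_fixedPoint [CompleteSpace X] (hD : IsInvariantConvex g D)
    (hg : ∀ x ∈ D, ∀ y ∈ D, ‖g x - g y‖ ≤ ‖x - y‖) {z : X} (hz : z ∈ D) {t : ℝ} (ht0 : 0 < t)
    (ht1 : t ≤ 1) : ∃ w ∈ D, (1 - t) • g w + t • z = w := by
  have hmaps : Set.MapsTo (fun w => (1 - t) • g w + t • z) D D := fun w hw =>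
    hD.convex (hD.mapsTo hw) hz (by linarith) ht0.le (by ring)
  obtain ⟨w, hw, hfix, -⟩ := ContractingWith.exists_fixedPoint' (K := (1 - t).toNNReal)
    hD.isClosed.isComplete hmaps
    ⟨by simpa using ht0, LipschitzWith.of_dist_le_mul fun x y => by
      rw [Subtype.dist_eq, Subtype.dist_eq, dist_eq_norm, dist_eq_norm]
      simp only [Set.MapsTo.val_restrict_apply]
      rw [add_sub_add_right_eq_sub, ← smul_sub, norm_smul, Real.norm_of_nonneg (by linarith),
        Real.coe_toNNReal _ (by linarith)]
      exact mul_le_mul_of_nonneg_left (hg _ x.2 _ y.2) (by linarith)⟩ hz (edist_ne_top _ _)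
  exact ⟨w, hw, hfix⟩

/-- A minimal invariant set is diametral. -/
theorem Minimal.norm_sub_le_of_forall_norm_sub_le (hD : Minimal (IsInvariantConvex g) D)
    (hg : ∀ x ∈ D, ∀ y ∈ D, ‖g x - g y‖ ≤ ‖x - y‖) {z : X} (hz : z ∈ D) {r : ℝ}
    (hr : ∀ v ∈ D, ‖v - z‖ ≤ r) : ∀ x ∈ D, ∀ y ∈ D, ‖x - y‖ ≤ r := by
  -- The points of D whose r-ball contains D form an invariant convex set containing z, so by
  -- minimality they exhaust D.
  have hE : D ⊆ {x ∈ D | ∀ v ∈ D, ‖x - v‖ ≤ r} := by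
    refine hD.le_of_le ⟨⟨z, hz, fun v hv => by rw [norm_sub_rev]; exact hr v hv⟩, ?_, ?_, ?_⟩
      (Set.sep_subset _ _)
    · have : {x ∈ D | ∀ v ∈ D, ‖x - v‖ ≤ r} = D ∩ ⋂ v ∈ D, Metric.closedBall v r := by
        ext x; simp [dist_eq_norm]
      rw [this]
      exact hD.prop.isClosed.inter (isClosed_biInter fun v _ => Metric.isClosed_closedBall)
    · have : {x ∈ D | ∀ v ∈ D, ‖x - v‖ ≤ r} = D ∩ ⋂ v ∈ D, Metric.closedBall v r := by
        ext x; simp [dist_eq_norm]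
      rw [this]
      exact hD.prop.convex.inter (convex_iInter₂ fun v _ => convex_closedBall v r)
    · rintro x ⟨hx, hxr⟩
      refine ⟨hD.prop.mapsTo hx, fun v hv => ?_⟩
      -- Since D lies in the r-ball about x, g maps all of D into the r-ball about g x; minimality
      -- puts D itself in that ball.
      have hsub : D ⊆ D ∩ Metric.closedBall (g x) r := by
        refine hD.le_of_le ⟨⟨g x, hD.prop.mapsTo hx, Metric.mem_closedBall_self ?_⟩,
          hD.prop.isClosed.inter Metric.isClosed_closedBall,
          hD.prop.convex.inter (convex_closedBall _ _), ?_⟩ Set.inter_subset_left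
        · exact (norm_nonneg _).trans (hr z hz)
        · rintro v ⟨hv, -⟩
          refine ⟨hD.prop.mapsTo hv, ?_⟩
          rw [mem_closedBall_iff_norm]
          refine (hg v hv x hx).trans ?_
          rw [norm_sub_rev]
          exact hxr v hv
      have := (hsub hv).2
      rwa [mem_closedBall_iff_norm, norm_sub_rev] at this
  exact fun x hx => (hE hx).2

/-- The Goebel-Karlovitz lemma, in contrapositive form. -/
theorem Minimal.norm_sub_le_of_approxFixed (𝕜 : Type*) [RCLike 𝕜] [NormedSpace 𝕜 X]
    [IsScalarTower ℝ 𝕜 X] (hD : Minimal (IsInvariantConvex g) D)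
    (hg : ∀ x ∈ D, ∀ y ∈ D, ‖g x - g y‖ ≤ ‖x - y‖) (hcpt : IsCompact (toWeakSpace 𝕜 X '' D))
    {ι : Type*} (U : Ultrafilter ι) {u : ι → X} (hu : ∀ n, u n ∈ D)
    (huT : Tendsto (fun n => ‖g (u n) - u n‖) U (𝓝 0)) {y : X} (hy : y ∈ D) {s : ℝ}
    (hs : ∀ n, ‖u n - y‖ ≤ s) : ∀ a ∈ D, ∀ b ∈ D, ‖a - b‖ ≤ s := by
  -- The condition says that the limit of ‖u n - z‖ along U is at most s. It is invariant because
  -- the u n are asymptotically fixed.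
  have hE : D ⊆ {z ∈ D | ∀ ε > 0, ∀ᶠ n in U, ‖u n - z‖ ≤ s + ε} := by
    refine hD.le_of_le ⟨⟨y, hy, fun ε hε => Eventually.of_forall fun n => (hs n).trans
      (by linarith)⟩, ?_, ?_, ?_⟩ (Set.sep_subset _ _)
    · refine isClosed_of_closure_subset fun z hz => ?_
      refine ⟨hD.prop.isClosed.closure_subset_iff.2 (Set.sep_subset _ _) hz, fun ε hε => ?_⟩
      obtain ⟨z', ⟨-, hz'⟩, hzz'⟩ := Metric.mem_closure_iff.1 hz (ε / 2) (by positivity)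
      filter_upwards [hz' (ε / 2) (by positivity)] with n hn
      have := norm_sub_le_norm_sub_add_norm_sub (u n) z' z
      rw [dist_comm, dist_eq_norm] at hzz'
      linarith
    · rintro a ⟨ha, hal⟩ b ⟨hb, hbl⟩ p q hp hq hpq
      refine ⟨hD.prop.convex ha hb hp hq hpq, fun ε hε => ?_⟩
      filter_upwards [hal ε hε, hbl ε hε] with n hna hnb
      have h1 : u n - (p • a + q • b) = p • (u n - a) + q • (u n - b) := by
        rw [smul_sub, smul_sub, sub_add_sub_comm, ← add_smul, hpq, one_smul]
      rw [h1]
      refine (norm_add_le _ _).trans ?_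
      rw [norm_smul, norm_smul, Real.norm_of_nonneg hp, Real.norm_of_nonneg hq]
      calc p * ‖u n - a‖ + q * ‖u n - b‖ ≤ p * (s + ε) + q * (s + ε) := by gcongr
        _ = s + ε := by rw [← add_mul, hpq, one_mul]
    · rintro z ⟨hz, hzl⟩
      refine ⟨hD.prop.mapsTo hz, fun ε hε => ?_⟩
      filter_upwards [hzl (ε / 2) (by positivity),
        huT.eventually_le_const (show (0 : ℝ) < ε / 2 by positivity)] with n hn1 hn2
      have h1 := norm_sub_le_norm_sub_add_norm_sub (u n) (g (u n)) (g z)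
      have h2 := hg _ (hu n) _ hz
      rw [norm_sub_rev (u n) (g (u n))] at h1
      linarith
  -- Weak lower semicontinuity of the norm turns the bound on ‖u n - z‖ into ‖v - z‖ ≤ s for every z
  -- in D, to which diametrality applies.
  obtain ⟨v, hv, hlim⟩ := exists_weak_ultrafilter_limit hcpt U hu
  refine hD.norm_sub_le_of_forall_norm_sub_le hg hv fun z hz => ?_
  refine le_of_forall_pos_le_add fun ε hε => ?_
  rw [norm_sub_rev]
  refine norm_le_of_weak_tendsto (𝕜 := 𝕜) (l := (U : Filter ι)) (w := fun n => u n - z)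
    (fun f => ?_) ((hE hz).2 ε hε)
  simp only [map_sub]
  exact (hlim f).sub_const _

end Minimal

/-! ### The fixed point theorem under the bound on sums. -/

section FixedPoint

variable {X : Type*} [NormedAddCommGroup X] [NormedSpace ℝ X] {g : X → X}
  {D : Set X}

/-- The solution of w = (1 - t) g w + t b depends nonexpansively on the anchor b. -/
theorem norm_sub_fixedPoint_le {t : ℝ} (ht0 : 0 < t) (ht1 : t ≤ 1) {v w a b : X}
    (hg : ‖g v - g w‖ ≤ ‖v - w‖) (hv : (1 - t) • g v + t • a = v)
    (hw : (1 - t) • g w + t • b = w) : ‖v - w‖ ≤ ‖a - b‖ := by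
  have h1 : v - w = (1 - t) • (g v - g w) + t • (a - b) := by
    nth_rewrite 1 [← hv, ← hw]
    module
  have h2 : ‖v - w‖ ≤ (1 - t) * ‖v - w‖ + t * ‖a - b‖ := by
    calc ‖v - w‖ = ‖(1 - t) • (g v - g w) + t • (a - b)‖ := by rw [← h1]
      _ ≤ (1 - t) * ‖g v - g w‖ + t * ‖a - b‖ := by
        refine (norm_add_le _ _).trans_eq ?_
        rw [norm_smul, norm_smul, Real.norm_of_nonneg (by linarith), Real.norm_of_nonneg ht0.le]
      _ ≤ _ := by gcongr
  nlinarith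

theorem norm_map_sub_fixedPoint_le {t d : ℝ} (ht0 : 0 < t) {w z : X}
    (hw : (1 - t) • g w + t • z = w) (hd : ‖g w - z‖ ≤ d) : ‖g w - w‖ ≤ t * d := by
  have h1 : g w - w = t • (g w - z) := by
    nth_rewrite 2 [← hw]
    module
  rw [h1, norm_smul, Real.norm_of_nonneg ht0.le]
  gcongr

/-- When x is almost fixed, w stays almost as close to x as its anchor z is; the error ‖g x - x‖ / t
vanishes in the limit because t is held fixed. -/
theorem norm_fixedPoint_sub_le {t : ℝ} (ht0 : 0 < t) (ht1 : t ≤ 1) {w x z : X}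
    (hg : ‖g w - g x‖ ≤ ‖w - x‖) (hw : (1 - t) • g w + t • z = w) :
    ‖w - x‖ ≤ ‖g x - x‖ / t + ‖z - x‖ := by
  have h1 : w - x = (1 - t) • (g w - g x) + ((1 - t) • (g x - x) + t • (z - x)) := by
    nth_rewrite 1 [← hw]
    module
  have h2 : ‖w - x‖ ≤ (1 - t) * ‖w - x‖ + (1 * ‖g x - x‖ + t * ‖z - x‖) := by
    calc ‖w - x‖ = ‖(1 - t) • (g w - g x) + ((1 - t) • (g x - x) + t • (z - x))‖ := by rw [← h1]
      _ ≤ (1 - t) * ‖g w - g x‖ + ((1 - t) * ‖g x - x‖ + t * ‖z - x‖) := by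
        refine (norm_add_le _ _).trans (add_le_add (le_of_eq ?_)
          ((norm_add_le _ _).trans_eq ?_))
        · rw [norm_smul, Real.norm_of_nonneg (by linarith)]
        · rw [norm_smul, norm_smul, Real.norm_of_nonneg (by linarith), Real.norm_of_nonneg ht0.le]
      _ ≤ _ := by gcongr; linarith
  rw [div_add' _ _ _ ht0.ne', le_div_iff₀ ht0]
  nlinarith

/-- A minimal invariant weakly compact convex set consists of one point, when the space satisfies
the uniform bound for sums with weakly null sequences. -/
theorem WeakNullSumBound.subsingleton_of_minimal [CompleteSpace X] {𝕜 : Type*} [RCLike 𝕜] [NormedSpace 𝕜 X]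
    [IsScalarTower ℝ 𝕜 X] (hX : WeakNullSumBound 𝕜 X) (hD : Minimal (IsInvariantConvex g) D)
    (hg : ∀ x ∈ D, ∀ y ∈ D, ‖g x - g y‖ ≤ ‖x - y‖)
    (hcpt : IsCompact (toWeakSpace 𝕜 X '' D)) : D.Subsingleton := by
  by_contra hns
  obtain ⟨M, hM⟩ := exists_norm_le_of_isCompact_weak hcpt
  have hbdd : Bornology.IsBounded D := isBounded_iff_forall_norm_le.2 ⟨M, hM⟩
  set d := Metric.diam D with hd
  have hdle : ∀ x ∈ D, ∀ y ∈ D, ‖x - y‖ ≤ d := fun x hx y hy => by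
    rw [← dist_eq_norm]; exact Metric.dist_le_diam_of_mem hbdd hx hy
  have hd0 : 0 < d := by
    obtain ⟨x, hx, y, hy, hxy⟩ := Set.not_subsingleton_iff.1 hns
    exact (norm_pos_iff.2 (sub_ne_zero.2 hxy)).trans_le (hdle x hx y hy)
  obtain ⟨z₀, hz₀⟩ := hD.prop.nonempty
  set t : ℕ → ℝ := fun n => 1 / ((n : ℝ) + 1) with ht
  have ht0 : ∀ n, 0 < t n := fun n => Nat.one_div_pos_of_nat
  have ht1 : ∀ n, t n ≤ 1 := fun n => by
    rw [ht]; exact div_le_one_of_le₀ (by simp) (by positivity)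
  have htl : Tendsto (fun n => t n * d) (hyperfilter ℕ) (𝓝 0) := by
    have := (tendsto_one_div_add_atTop_nhds_zero_nat (𝕜 := ℝ)).mul_const d
    rw [zero_mul] at this
    exact this.mono_left Nat.hyperfilter_le_atTop
  choose x hxD hx using fun n => exists_eq_lineMap_fixedPoint hD.prop hg hz₀ (ht0 n) (ht1 n)
  have hxT : Tendsto (fun n => ‖g (x n) - x n‖) (hyperfilter ℕ) (𝓝 0) :=
    squeeze_zero (fun n => norm_nonneg _) (fun n => norm_map_sub_fixedPoint_le (ht0 n) (hx n)
      (hdle _ (hD.prop.mapsTo (hxD n)) _ hz₀)) htl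
  obtain ⟨p, hp, hxp⟩ := exists_weak_ultrafilter_limit hcpt (hyperfilter ℕ) hxD
  obtain ⟨δ, hδ, H⟩ := hX
  -- With k fixed and n varying, anchoring at the midpoints of `x n` and p makes both ‖w n - q‖ and
  -- ‖q - p‖ at most d/2, where q is the weak limit of w. Scaling by 2/d brings `w n - q` and `q -
  -- p` into the unit ball, and their sum is a multiple of `w n - p`.
  have key : ∀ k, ∃ v ∈ D, ‖g v - v‖ ≤ t k * d ∧ ‖v - p‖ ≤ d / 2 * (2 - δ) := by
    intro k
    have hmid : ∀ n, (1 / 2 : ℝ) • x n + (1 / 2 : ℝ) • p ∈ D := fun n =>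
      hD.prop.convex (hxD n) hp (by norm_num) (by norm_num) (by norm_num)
    choose w hwD hw using fun n =>
      exists_eq_lineMap_fixedPoint hD.prop hg (hmid n) (ht0 k) (ht1 k)
    obtain ⟨q, hq, hwq⟩ := exists_weak_ultrafilter_limit hcpt (hyperfilter ℕ) hwD
    have hww : ∀ n m, ‖w n - w m‖ ≤ d / 2 := fun n m => by
      refine (norm_sub_fixedPoint_le (ht0 k) (ht1 k) (hg _ (hwD n) _ (hwD m)) (hw n)
        (hw m)).trans ?_
      rw [add_sub_add_right_eq_sub, ← smul_sub, norm_smul]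
      have := hdle _ (hxD n) _ (hxD m)
      norm_num
      linarith
    have hwq2 : ∀ n, ‖w n - q‖ ≤ d / 2 := fun n => by
      refine norm_le_of_weak_tendsto (𝕜 := 𝕜) (l := (hyperfilter ℕ : Filter ℕ))
        (w := fun m => w n - w m) (fun f => ?_) (Eventually.of_forall fun m => hww n m)
      simp only [map_sub]
      exact (hwq f).const_sub _
    have hqp : ‖q - p‖ ≤ d / 2 := by
      refine le_of_forall_pos_le_add fun ε hε => ?_
      refine norm_le_of_weak_tendsto (𝕜 := 𝕜) (l := (hyperfilter ℕ : Filter ℕ))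
        (w := fun n => w n - x n) (fun f => ?_) ?_
      · simp only [map_sub]
        exact (hwq f).sub (hxp f)
      · filter_upwards [hxT.eventually_le_const (show 0 < ε * t k from mul_pos hε (ht0 k))]
          with n hn
        have h1 := norm_fixedPoint_sub_le (ht0 k) (ht1 k) (hg _ (hwD n) _ (hxD n)) (hw n)
        have h2 : ‖g (x n) - x n‖ / t k ≤ ε := by rwa [div_le_iff₀ (ht0 k)]
        have h3 : (1 / 2 : ℝ) • x n + (1 / 2 : ℝ) • p - x n = (1 / 2 : ℝ) • (p - x n) := by module
        have h4 := hdle _ hp _ (hxD n)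
        rw [h3, norm_smul] at h1
        norm_num at h1
        linarith
    have hscale : ∀ v : X, ‖v‖ ≤ d / 2 → ‖(2 / d) • v‖ ≤ 1 := fun v hv => by
      rw [norm_smul, Real.norm_of_nonneg (by positivity), div_mul_eq_mul_div, div_le_one hd0]
      linarith
    obtain ⟨n, hn⟩ := H (fun n => (2 / d) • (w n - q)) ((2 / d) • (q - p))
      (fun n => hscale _ (hwq2 n)) (hscale _ hqp) (fun f => by
        have h1 : Tendsto (fun n => (2 / d) • (f (w n) - f q)) (hyperfilter ℕ) (𝓝 0) := by
          have := ((hwq f).sub_const (f q)).const_smul (2 / d)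
          rwa [sub_self, smul_zero] at this
        refine h1.congr fun n => ?_
        rw [← algebraMap_smul 𝕜 (2 / d : ℝ) (w n - q), map_smul, map_sub, algebraMap_smul])
    refine ⟨w n, hwD n, norm_map_sub_fixedPoint_le (ht0 k) (hw n)
      (hdle _ (hD.prop.mapsTo (hwD n)) _ (hmid n)), ?_⟩
    rw [← smul_add, sub_add_sub_cancel, norm_smul, Real.norm_of_nonneg (by positivity),
      div_mul_eq_mul_div, div_le_iff₀ hd0] at hn
    linarith
  choose v hvD hvT hvp using key
  have hdiam := hD.norm_sub_le_of_approxFixed 𝕜 hg hcpt (hyperfilter ℕ) hvD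
    (squeeze_zero (fun n => norm_nonneg _) hvT htl) hp hvp
  have hfin : d ≤ d / 2 * (2 - δ) :=
    Metric.diam_le_of_forall_dist_le ((norm_nonneg _).trans (hvp 0)) fun a ha b hb => by
      rw [dist_eq_norm]; exact hdiam a ha b hb
  nlinarith

end FixedPoint

theorem WeakNullSumBound.hasWeakFPP {𝕜 X : Type*} [RCLike 𝕜] [NormedAddCommGroup X]
    [NormedSpace 𝕜 X] [CompleteSpace X] (hX : WeakNullSumBound 𝕜 X) : HasWeakFPP 𝕜 X := by
  let _ : NormedSpace ℝ X := NormedSpace.restrictScalars ℝ 𝕜 X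
  have _ : IsScalarTower ℝ 𝕜 X := IsScalarTower.restrictScalars ℝ 𝕜 X
  intro C hne hcpt hconv T hT
  classical
  set g : X → X := fun x => if h : x ∈ C then (T ⟨x, h⟩ : X) else x with hgdef
  have hgC : ∀ (x : X) (h : x ∈ C), g x = T ⟨x, h⟩ := fun x h => dif_pos h
  have hg : ∀ x ∈ C, ∀ y ∈ C, ‖g x - g y‖ ≤ ‖x - y‖ := fun x hx y hy => by
    have := hT.dist_le_mul ⟨x, hx⟩ ⟨y, hy⟩
    rw [hgC x hx, hgC y hy]
    rwa [NNReal.coe_one, one_mul, Subtype.dist_eq, Subtype.dist_eq, dist_eq_norm,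
      dist_eq_norm] at this
  have hclosed : IsClosed C := by
    have h1 := hcpt.isClosed.preimage (toWeakSpaceCLM 𝕜 X).continuous
    rwa [show ((toWeakSpaceCLM 𝕜 X : X → WeakSpace 𝕜 X)) = toWeakSpace 𝕜 X from rfl,
      Set.preimage_image_eq _ (toWeakSpace 𝕜 X).injective] at h1
  obtain ⟨D, hDC, hD⟩ := exists_minimal_isInvariantConvex 𝕜 hcpt
    (⟨hne, hclosed, hconv, fun x hx => by rw [hgC x hx]; exact Subtype.coe_prop _⟩ :
      IsInvariantConvex g C)
  have hDs := hX.subsingleton_of_minimal hD (fun x hx y hy => hg x (hDC hx) y (hDC hy))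
    (hcpt.of_isClosed_subset (isClosed_image_toWeakSpace hD.prop.isClosed hD.prop.convex)
      (Set.image_mono hDC))
  obtain ⟨x, hx⟩ := hD.prop.nonempty
  refine ⟨⟨x, hDC hx⟩, Subtype.ext ?_⟩
  rw [← hgC x (hDC hx)]
  exact hDs (hD.prop.mapsTo hx) hx

/-! ### The space c₀. -/

section ZeroAtInfty

variable {𝕜 : Type*} [RCLike 𝕜]

theorem ZeroAtInftyContinuousMap.norm_le_of_forall_norm_apply_le {α : Type*} [TopologicalSpace α]
    {f : C₀(α, 𝕜)} {r : ℝ} (hr : 0 ≤ r) (h : ∀ i, ‖f i‖ ≤ r) : ‖f‖ ≤ r := by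
  rw [← ZeroAtInftyContinuousMap.norm_toBCF_eq_norm]
  exact (BoundedContinuousFunction.norm_le hr).2 h

theorem ZeroAtInftyContinuousMap.norm_apply_le_norm {α : Type*} [TopologicalSpace α]
    (f : C₀(α, 𝕜)) (i : α) : ‖f i‖ ≤ ‖f‖ := by
  rw [← ZeroAtInftyContinuousMap.norm_toBCF_eq_norm]
  exact f.toBCF.norm_coe_le_norm i

theorem weakNullSumBound_zeroAtInfty : WeakNullSumBound 𝕜 C₀(ℕ, 𝕜) := by
  refine ⟨1 / 2, by norm_num, fun u y hu hy hw => ?_⟩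
  -- Only finitely many coordinates of y exceed 1/2, and on those u n is eventually at most 1/2;
  -- every coordinate of the sum is then at most 3/2.
  have hfin : {i : ℕ | ¬ ‖y i‖ ≤ 1 / 2}.Finite := by
    have h1 := (zero_at_infty y).norm
    rw [norm_zero, cocompact_eq_cofinite] at h1
    exact h1.eventually_le_const (by norm_num)
  have hev : ∀ᶠ n in (hyperfilter ℕ : Filter ℕ), ∀ i ∈ {i : ℕ | ¬ ‖y i‖ ≤ 1 / 2},
      ‖u n i‖ ≤ 1 / 2 := by
    rw [eventually_all_finite hfin]
    intro i _
    let ev : StrongDual 𝕜 C₀(ℕ, 𝕜) := LinearMap.mkContinuous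
      { toFun := fun f => f i, map_add' := fun _ _ => rfl, map_smul' := fun _ _ => rfl } 1
      (fun f => by simpa using f.norm_apply_le_norm i)
    have h1 := (hw ev).norm
    rw [norm_zero] at h1
    exact h1.eventually_le_const (by norm_num)
  obtain ⟨n, hn⟩ := hev.exists
  refine ⟨n, ZeroAtInftyContinuousMap.norm_le_of_forall_norm_apply_le (by norm_num) fun i => ?_⟩
  have h1 := norm_add_le (u n i) (y i)
  rw [ZeroAtInftyContinuousMap.coe_add, Pi.add_apply]
  by_cases hi : ‖y i‖ ≤ 1 / 2
  · linarith [((u n).norm_apply_le_norm i).trans (hu n)]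
  · linarith [hn i hi, (y.norm_apply_le_norm i).trans hy]

end ZeroAtInfty

/-! ### Compact operators on a Hilbert space. -/

section CompactOperator

open scoped InnerProductSpace

variable {𝕜 H : Type*} [RCLike 𝕜] [NormedAddCommGroup H] [InnerProductSpace 𝕜 H]
  [CompleteSpace H]

theorem exists_inner_ultrafilter_limit {ι : Type*} (U : Ultrafilter ι) {ξ : ι → H}
    (hξ : ∀ n, ‖ξ n‖ ≤ 1) :
    ∃ x : H, ‖x‖ ≤ 1 ∧ ∀ η, Tendsto (fun n => ⟪ξ n, η⟫_𝕜) U (𝓝 ⟪x, η⟫_𝕜) := by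
  obtain ⟨φ, hφ, hle⟩ := (WeakDual.isCompact_closedBall (𝕜 := 𝕜) (0 : StrongDual 𝕜 H) 1).ultrafilter_le_nhds
    (U.map fun n => StrongDual.toWeakDual (InnerProductSpace.toDual 𝕜 H (ξ n)))
    (by
      rw [Ultrafilter.coe_map, le_principal_iff, mem_map]
      exact univ_mem' fun n => by simpa using hξ n)
  refine ⟨(InnerProductSpace.toDual 𝕜 H).symm (WeakDual.toStrongDual φ), by simpa using hφ,
    fun η => ?_⟩
  rw [InnerProductSpace.toDual_symm_apply]
  exact ((WeakDual.eval_continuous η).tendsto φ).comp hle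

/-- Compactness supplies a norm limit of T (ξ n); testing against vectors through the adjoint
identifies it as T x. -/
theorem IsCompactOperator.tendsto_of_inner_tendsto {ι : Type*} {U : Ultrafilter ι} {ξ : ι → H}
    {T : H →L[𝕜] H} (hT : IsCompactOperator T) (hξ : ∀ n, ‖ξ n‖ ≤ 1) {x : H}
    (hx : ∀ η, Tendsto (fun n => ⟪ξ n, η⟫_𝕜) U (𝓝 ⟪x, η⟫_𝕜)) :
    Tendsto (fun n => T (ξ n)) U (𝓝 (T x)) := by
  have hK := IsCompactOperator.isCompact_closure_image_closedBall (f := (T : H →ₗ[𝕜] H)) hT 1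
  obtain ⟨v, -, hv⟩ := hK.ultrafilter_le_nhds (U.map fun n => T (ξ n)) (by
    rw [Ultrafilter.coe_map, le_principal_iff, mem_map]
    exact univ_mem' fun n => subset_closure ⟨ξ n, by simpa using hξ n, rfl⟩)
  have hv' : Tendsto (fun n => T (ξ n)) U (𝓝 v) := hv
  suffices v = T x by rwa [← this]
  refine ext_inner_right 𝕜 fun η => ?_
  refine tendsto_nhds_unique (hv'.inner (tendsto_const_nhds (x := η))) ?_
  simp only [← ContinuousLinearMap.adjoint_inner_right]
  exact hx _

theorem weakNullSumBound_compactOperator :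
    WeakNullSumBound 𝕜 (compactOperator (RingHom.id 𝕜) H H) := by
  refine ⟨1 / 4, by norm_num, fun u y hu hy hw => ?_⟩
  by_contra! hcon
  choose ξ hξ1 hξ2 using fun n =>
    ((u n : H →L[𝕜] H) + (y : H →L[𝕜] H)).exists_lt_apply_of_lt_opNorm (hcon n)
  obtain ⟨x, hx1, hx⟩ := exists_inner_ultrafilter_limit (𝕜 := 𝕜) (hyperfilter ℕ)
    (fun n => (hξ1 n).le)
  set Y : H →L[𝕜] H := y.1 with hY
  have hyξ := IsCompactOperator.tendsto_of_inner_tendsto (T := Y) y.2 (fun n => (hξ1 n).le) hx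
  have hop : ∀ (T : compactOperator (RingHom.id 𝕜) H H), ‖T‖ ≤ 1 → ∀ v : H,
      ‖(T : H →L[𝕜] H) v‖ ≤ ‖v‖ := fun T hT v =>
    ((T : H →L[𝕜] H).le_opNorm v).trans (mul_le_of_le_one_left (norm_nonneg _) hT)
  have hu0 : Tendsto (fun n => ⟪Y x, (u n : H →L[𝕜] H) x⟫_𝕜) (hyperfilter ℕ) (𝓝 0) :=
    hw (((innerSL 𝕜 (Y x)).comp (ContinuousLinearMap.apply 𝕜 H x)).comp
      (compactOperator (RingHom.id 𝕜) H H).subtypeL)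
  have hre : Tendsto (fun n => RCLike.re ⟪Y x, (u n : H →L[𝕜] H) x⟫_𝕜) (hyperfilter ℕ) (𝓝 0) := by
    have := (RCLike.continuous_re.tendsto (0 : 𝕜)).comp hu0
    rwa [map_zero] at this
  have hre2 : Tendsto (fun n => RCLike.re ⟪ξ n, x⟫_𝕜) (hyperfilter ℕ) (𝓝 (‖x‖ ^ 2)) := by
    have := (RCLike.continuous_re.tendsto _).comp (hx x)
    rwa [inner_self_eq_norm_sq] at this
  have hlow : Tendsto (fun n => (7 / 4 - ‖Y (ξ n) - Y x‖)) (hyperfilter ℕ) (𝓝 (7 / 4)) := by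
    have := (tendsto_iff_norm_sub_tendsto_zero.1 hyξ).const_sub (7 / 4)
    rwa [sub_zero] at this
  -- This majorant of ‖Y x + A (ξ n)‖² comes from splitting A (ξ n) = A x + A (ξ n - x) and using
  -- 2‖x‖‖ξ n - x‖ ≤ ‖x‖² + ‖ξ n - x‖². Its limit is 2 + ‖x‖² ≤ 3, whereas the lower bound tends to
  -- 49/16.
  have hup : Tendsto (fun n => 2 + 3 * ‖x‖ ^ 2 - 2 * RCLike.re ⟪ξ n, x⟫_𝕜 +
      2 * RCLike.re ⟪Y x, (u n : H →L[𝕜] H) x⟫_𝕜) (hyperfilter ℕ)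
      (𝓝 (2 + 3 * ‖x‖ ^ 2 - 2 * ‖x‖ ^ 2 + 2 * 0)) :=
    ((hre2.const_mul 2).const_sub _).add (hre.const_mul 2)
  have hfin := le_of_tendsto_of_tendsto (hlow.pow 2) hup (by
    filter_upwards [hlow.eventually_const_le (show (0 : ℝ) < 7 / 4 by norm_num)] with n hn
    set A : H →L[𝕜] H := (u n).1 with hA
    have h1 : 7 / 4 - ‖Y (ξ n) - Y x‖ ≤ ‖Y x + A (ξ n)‖ := by
      have h2 := hξ2 n
      have h3 : (A + Y) (ξ n) = (Y x + A (ξ n)) + (Y (ξ n) - Y x) := by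
        rw [add_apply]; abel
      have h4 := norm_add_le (Y x + A (ξ n)) (Y (ξ n) - Y x)
      rw [← h3] at h4
      linarith
    have h5 : A (ξ n) = A x + A (ξ n - x) := by rw [map_sub]; abel
    have h6 : RCLike.re ⟪Y x, A (ξ n)⟫_𝕜 ≤ RCLike.re ⟪Y x, A x⟫_𝕜 + ‖x‖ * ‖ξ n - x‖ := by
      rw [h5, inner_add_right, map_add]
      gcongr
      refine (re_inner_le_norm _ _).trans ?_
      gcongr
      · exact hop y hy x
      · exact hop (u n) (hu n) _
    have h7 := norm_add_sq (𝕜 := 𝕜) (Y x) (A (ξ n))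
    have h8 := norm_sub_sq (𝕜 := 𝕜) (ξ n) x
    have h9 : ‖Y x‖ ^ 2 ≤ ‖x‖ ^ 2 := by gcongr; exact hop y hy x
    have h10 : ‖A (ξ n)‖ ^ 2 ≤ 1 ^ 2 := by
      gcongr; exact (hop (u n) (hu n) _).trans (hξ1 n).le
    have h11 : ‖ξ n‖ ^ 2 ≤ 1 ^ 2 := by gcongr; exact (hξ1 n).le
    have h12 : (7 / 4 - ‖Y (ξ n) - Y x‖) ^ 2 ≤ ‖Y x + A (ξ n)‖ ^ 2 := by gcongr
    nlinarith [sq_nonneg (‖x‖ - ‖ξ n - x‖)])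
  nlinarith [norm_nonneg x]

instance completeSpace_compactOperator : CompleteSpace (compactOperator (RingHom.id 𝕜) H H) :=
  IsClosed.completeSpace_coe (hs := isClosed_setOfPred_isCompactOperator)

end CompactOperator

/-! ### Approximate factorization of analytic polynomials. -/

section Factorization

/-- The disc algebra, as the closed subalgebra of `C(𝕋)` generated by the coordinate function. -/
noncomputable def discAlgebra : Subalgebra ℂ C(UCircle, ℂ) :=
  (Algebra.adjoin ℂ {fourier 1}).topologicalClosure

theorem isClosed_discAlgebra : IsClosed (discAlgebra : Set C(UCircle, ℂ)) :=
  Subalgebra.isClosed_topologicalClosure _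

theorem fourier_one_mem_discAlgebra : fourier 1 ∈ discAlgebra :=
  Subalgebra.le_topologicalClosure _ (Algebra.subset_adjoin rfl)

theorem norm_fourier_apply (n : ℤ) (t : UCircle) : ‖fourier n t‖ = 1 := by
  rw [fourier_apply]; exact Circle.norm_coe _

theorem algebraMap_circle_apply (c : ℂ) (t : UCircle) : algebraMap ℂ C(UCircle, ℂ) c t = c := by
  simp [Algebra.algebraMap_eq_smul_one]

/-- An analytic logarithm of `1 - b z` for `|b| < 1`. -/
theorem exists_log_one_sub_mem_discAlgebra {b : ℂ} (hb : ‖b‖ < 1) :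
    ∃ l ∈ discAlgebra, ∀ t, Complex.exp (l t) = 1 - b * fourier 1 t := by
  have hnorm : ‖(b • fourier 1 : C(UCircle, ℂ))‖ = ‖b‖ := by
    rw [norm_smul, fourier_norm, mul_one]
  -- The term n = 0 vanishes because 0⁻¹ = 0, so this is the series of -log(1 - b z).
  have hsum : Summable fun n : ℕ => (n : ℂ)⁻¹ • (b • fourier 1 : C(UCircle, ℂ)) ^ n := by
    refine Summable.of_norm_bounded (summable_geometric_of_lt_one (norm_nonneg b) hb) fun n => ?_
    rw [norm_smul, norm_inv, Complex.norm_natCast]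
    calc (n : ℝ)⁻¹ * ‖(b • fourier 1 : C(UCircle, ℂ)) ^ n‖ ≤ 1 * ‖b‖ ^ n := by
          gcongr
          · exact Nat.cast_inv_le_one n
          · exact (norm_pow_le _ n).trans_eq (by rw [hnorm])
      _ = ‖b‖ ^ n := one_mul _
  have hmem : ∀ n : ℕ, (n : ℂ)⁻¹ • (b • fourier 1 : C(UCircle, ℂ)) ^ n ∈ discAlgebra := fun n =>
    discAlgebra.smul_mem (pow_mem (discAlgebra.smul_mem fourier_one_mem_discAlgebra _) n) _
  refine ⟨-∑' n : ℕ, (n : ℂ)⁻¹ • (b • fourier 1 : C(UCircle, ℂ)) ^ n,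
    neg_mem (isClosed_discAlgebra.mem_of_tendsto hsum.hasSum
      (Eventually.of_forall fun s => sum_mem fun n _ => hmem n)), fun t => ?_⟩
  have hz : ‖b * fourier 1 t‖ < 1 := by rwa [norm_mul, norm_fourier_apply, mul_one]
  have h1 : HasSum (fun n : ℕ => (b * fourier 1 t) ^ n / n)
      ((∑' n : ℕ, (n : ℂ)⁻¹ • (b • fourier 1 : C(UCircle, ℂ)) ^ n) t) := by
    have := (ContinuousMap.evalCLM ℂ t).hasSum hsum.hasSum
    refine this.congr_fun ?_
    intro n
    simp [div_eq_inv_mul]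
  have h2 := h1.unique (Complex.hasSum_taylorSeries_neg_log hz)
  rw [ContinuousMap.neg_apply, h2, neg_neg, Complex.exp_log]
  intro h0
  rw [sub_eq_zero] at h0
  rw [← h0] at hz
  simp at hz

theorem exists_exp_mem_discAlgebra {l : C(UCircle, ℂ)} (hl : l ∈ discAlgebra) :
    ∃ s ∈ discAlgebra, ∀ t, s t = Complex.exp (l t) := by
  refine ⟨NormedSpace.exp l, NormedSpace.exp_mem isClosed_discAlgebra hl, fun t => ?_⟩
  rw [Complex.exp_eq_exp_ℂ]
  exact NormedSpace.map_exp (ContinuousMap.evalAlgHom ℂ ℂ t) (ContinuousMap.evalCLM ℂ t).continuous l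

/-- Products `u v` of disc algebra functions with `|u| = |v|` on the circle. -/
def balancedProducts : Submonoid C(UCircle, ℂ) where
  carrier := {p | ∃ u ∈ discAlgebra, ∃ v ∈ discAlgebra, p = u * v ∧ ∀ t, ‖u t‖ = ‖v t‖}
  one_mem' := ⟨1, one_mem _, 1, one_mem _, (one_mul 1).symm, fun _ => rfl⟩
  mul_mem' := by
    rintro _ _ ⟨u, hu, v, hv, rfl, h⟩ ⟨u', hu', v', hv', rfl, h'⟩
    exact ⟨u * u', mul_mem hu hu', v * v', mul_mem hv hv', mul_mul_mul_comm _ _ _ _,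
      fun t => by simp [h t, h' t]⟩

theorem algebraMap_mem_balancedProducts (c : ℂ) :
    algebraMap ℂ C(UCircle, ℂ) c ∈ balancedProducts := by
  obtain ⟨s, hs⟩ := IsAlgClosed.exists_pow_nat_eq c (n := 2) (by norm_num)
  exact ⟨_, discAlgebra.algebraMap_mem s, _, discAlgebra.algebraMap_mem s,
    by rw [← map_mul, ← sq, hs], fun _ => rfl⟩

/-- Here z - a = -a (1 - z/a), and the second factor has an analytic square root. -/
theorem fourier_one_sub_mem_balancedProducts_of_one_lt {a : ℂ} (ha : 1 < ‖a‖) :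
    fourier 1 - algebraMap ℂ C(UCircle, ℂ) a ∈ balancedProducts := by
  have ha0 : a ≠ 0 := norm_pos_iff.1 (one_pos.trans ha)
  obtain ⟨l, hl, hl'⟩ := exists_log_one_sub_mem_discAlgebra (b := a⁻¹)
    (by rw [norm_inv]; exact inv_lt_one_of_one_lt₀ ha)
  obtain ⟨s, hs, hs'⟩ := exists_exp_mem_discAlgebra (discAlgebra.smul_mem hl (1 / 2))
  have h1 : fourier 1 - algebraMap ℂ C(UCircle, ℂ) a =
      algebraMap ℂ C(UCircle, ℂ) (-a) * (s * s) := by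
    ext t
    have h2 : s t * s t = 1 - a⁻¹ * fourier 1 t := by
      rw [hs' t, ← Complex.exp_add, ← hl' t]
      congr 1
      simp only [ContinuousMap.smul_apply, smul_eq_mul]
      ring
    simp only [ContinuousMap.sub_apply, ContinuousMap.mul_apply, h2,
      algebraMap_circle_apply]
    field_simp
    ring
  rw [h1]
  exact mul_mem (algebraMap_mem_balancedProducts _) ⟨s, hs, s, hs, rfl, fun _ => rfl⟩

/-- On the circle |z - a| = |1 - āz|. With s an analytic square root of 1 - āz, the factors are (z -
a)/s and s. -/
theorem fourier_one_sub_mem_balancedProducts_of_lt_one {a : ℂ} (ha : ‖a‖ < 1) :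
    fourier 1 - algebraMap ℂ C(UCircle, ℂ) a ∈ balancedProducts := by
  obtain ⟨l, hl, hl'⟩ := exists_log_one_sub_mem_discAlgebra (b := starRingEnd ℂ a)
    (by rwa [RCLike.norm_conj])
  obtain ⟨s, hs, hs'⟩ := exists_exp_mem_discAlgebra (discAlgebra.smul_mem hl (1 / 2))
  obtain ⟨s₁, hs₁, hs₁'⟩ := exists_exp_mem_discAlgebra (discAlgebra.smul_mem hl (-(1 / 2)))
  have hinv : ∀ t, s₁ t * s t = 1 := fun t => by
    rw [hs' t, hs₁' t, ← Complex.exp_add]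
    simp
  have hsq : ∀ t, ‖s t‖ * ‖s t‖ = ‖fourier 1 t - a‖ := fun t => by
    have h1 : s t * s t = 1 - starRingEnd ℂ a * fourier 1 t := by
      rw [hs' t, ← Complex.exp_add, ← hl' t]
      congr 1
      simp only [ContinuousMap.smul_apply, smul_eq_mul]
      ring
    have h2 : fourier 1 t - a = fourier 1 t * starRingEnd ℂ (s t * s t) := by
      have h3 : fourier 1 t * starRingEnd ℂ (fourier 1 t) = 1 := by
        rw [Complex.mul_conj, Complex.normSq_eq_norm_sq, norm_fourier_apply]; simp
      rw [h1, map_sub, map_mul, map_one, Complex.conj_conj, mul_sub, mul_one, mul_left_comm, h3,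
        mul_one]
    rw [h2, norm_mul, norm_fourier_apply, RCLike.norm_conj, norm_mul, one_mul]
  refine ⟨(fourier 1 - algebraMap ℂ C(UCircle, ℂ) a) * s₁,
    mul_mem (sub_mem fourier_one_mem_discAlgebra (discAlgebra.algebraMap_mem a)) hs₁, s, hs, ?_,
    fun t => ?_⟩
  · have : s₁ * s = 1 := by ext t; simpa using hinv t
    rw [mul_assoc, this, mul_one]
  · have h1 : ‖s₁ t‖ * ‖s t‖ = 1 := by rw [← norm_mul, hinv t, norm_one]
    simp only [ContinuousMap.mul_apply, ContinuousMap.sub_apply, algebraMap_circle_apply, norm_mul,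
      ← hsq t]
    linear_combination ‖s t‖ * h1

theorem fourier_one_sub_mem_closure_balancedProducts (a : ℂ) :
    fourier 1 - algebraMap ℂ C(UCircle, ℂ) a ∈ balancedProducts.topologicalClosure := by
  rcases lt_trichotomy ‖a‖ 1 with ha | ha | ha
  · exact balancedProducts.le_topologicalClosure (fourier_one_sub_mem_balancedProducts_of_lt_one ha)
  · have hlim : Tendsto (fun n : ℕ => fourier 1 -
        algebraMap ℂ C(UCircle, ℂ) ((1 + 1 / ((n : ℝ) + 1) : ℝ) * a)) atTop
        (𝓝 (fourier 1 - algebraMap ℂ C(UCircle, ℂ) a)) := by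
      have h1 : Tendsto (fun n : ℕ => ((1 + 1 / ((n : ℝ) + 1) : ℝ) : ℂ) * a) atTop (𝓝 a) := by
        have h2 := (tendsto_one_div_add_atTop_nhds_zero_nat (𝕜 := ℝ)).const_add 1
        have h3 := ((Complex.continuous_ofReal.tendsto _).comp h2).mul_const a
        simpa using h3
      exact (((algebraMapCLM ℂ C(UCircle, ℂ)).continuous.tendsto a).comp h1).const_sub _
    refine balancedProducts.isClosed_topologicalClosure.mem_of_tendsto hlim
      (Eventually.of_forall fun n => balancedProducts.le_topologicalClosure
        (fourier_one_sub_mem_balancedProducts_of_one_lt ?_))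
    have h0 : 0 < 1 / ((n : ℝ) + 1) := Nat.one_div_pos_of_nat
    rw [norm_mul, Complex.norm_real, ha, mul_one, Real.norm_of_nonneg (by linarith)]
    linarith
  · exact balancedProducts.le_topologicalClosure (fourier_one_sub_mem_balancedProducts_of_one_lt ha)

/-- A complex polynomial splits into linear factors, and balanced products are closed under
multiplication. Passing to the closure is what admits roots on the circle. -/
theorem adjoin_fourier_one_subset_closure_balancedProducts {p : C(UCircle, ℂ)}
    (hp : p ∈ Algebra.adjoin ℂ {(fourier 1 : C(UCircle, ℂ))}) :
    p ∈ balancedProducts.topologicalClosure := by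
  rw [Algebra.adjoin_singleton_eq_range_aeval] at hp
  obtain ⟨P, rfl⟩ := hp
  rw [AlgHom.toRingHom_eq_coe, RingHom.coe_coe, (IsAlgClosed.splits P).eq_prod_roots, map_mul, Polynomial.aeval_C,
    map_multiset_prod]
  refine mul_mem (balancedProducts.le_topologicalClosure (algebraMap_mem_balancedProducts _))
    (Submonoid.multiset_prod_mem _ _ fun q hq => ?_)
  simp only [Multiset.map_map, Multiset.mem_map, Function.comp_apply, map_sub, Polynomial.aeval_X,
    Polynomial.aeval_C] at hq
  obtain ⟨a, -, rfl⟩ := hq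
  exact fourier_one_sub_mem_closure_balancedProducts a

end Factorization

/-! ### Hankel operators with continuous symbols. -/

section Hankel

open MeasureTheory
open scoped InnerProductSpace ENNReal

/-- The space `L²(𝕋)`. -/
noncomputable abbrev CircleL2 : Type := Lp ℂ 2 (AddCircle.haarAddCircle (T := 2 * Real.pi))

/-- A continuous function on the circle, as an element of `L²(𝕋)`. -/
noncomputable abbrev circleToL2 : C(UCircle, ℂ) →L[ℂ] CircleL2 :=
  ContinuousMap.toLp 2 AddCircle.haarAddCircle ℂ

/-- The operator on `L²(𝕋)` of multiplication by a continuous function. -/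
noncomputable def circleMulL : C(UCircle, ℂ) →L[ℂ] CircleL2 →L[ℂ] CircleL2 :=
  ((ContinuousLinearMap.mul ℂ ℂ).holderL AddCircle.haarAddCircle ∞ 2 2).comp
    (ContinuousMap.toLp ∞ AddCircle.haarAddCircle ℂ)

theorem circleMulL_toL2 (F g : C(UCircle, ℂ)) :
    circleMulL F (circleToL2 g) = circleToL2 (F * g) := by
  refine Lp.ext ?_
  have h1 := (ContinuousLinearMap.mul ℂ ℂ).coeFn_holder (r := 2)
    (ContinuousMap.toLp ∞ AddCircle.haarAddCircle ℂ F) (circleToL2 g)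
  refine h1.trans ?_
  filter_upwards [ContinuousMap.coeFn_toLp (p := ∞) (𝕜 := ℂ) AddCircle.haarAddCircle F,
    ContinuousMap.coeFn_toLp (p := 2) (𝕜 := ℂ) AddCircle.haarAddCircle g,
    ContinuousMap.coeFn_toLp (p := 2) (𝕜 := ℂ) AddCircle.haarAddCircle (F * g)] with t h2 h3 h4
  rw [h2, h3, h4]
  rfl

theorem norm_circleMulL_le (F : C(UCircle, ℂ)) : ‖circleMulL F‖ ≤ ‖F‖ := by
  have h1 : ‖ContinuousMap.toLp ∞ (AddCircle.haarAddCircle (T := 2 * Real.pi)) ℂ F‖ ≤ ‖F‖ := by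
    refine (ContinuousLinearMap.le_opNorm _ _).trans (mul_le_of_le_one_left (norm_nonneg _) ?_)
    refine (ContinuousMap.toLp_norm_le (μ := AddCircle.haarAddCircle) (p := ∞)).trans ?_
    simp
  have h2 := ((ContinuousLinearMap.mul ℂ ℂ).holderL
    (AddCircle.haarAddCircle (T := 2 * Real.pi)) ∞ 2 2).le_opNorm
      (ContinuousMap.toLp ∞ AddCircle.haarAddCircle ℂ F)
  refine h2.trans ((mul_le_of_le_one_left (norm_nonneg _) ?_).trans h1)
  exact (ContinuousLinearMap.mul ℂ ℂ).norm_holderL_le.trans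
    (ContinuousLinearMap.opNorm_mul_le ℂ ℂ)

theorem inner_fourierLp_circleMulL (F : C(UCircle, ℂ)) (n m : ℤ) :
    ⟪(fourierLp 2 n : CircleL2), circleMulL F (fourierLp 2 m)⟫_ℂ =
      fourierCoeff (F : UCircle → ℂ) (n - m) := by
  rw [fourierLp, fourierLp, circleMulL_toL2, ContinuousMap.inner_toLp, fourierCoeff]
  refine integral_congr_ae (Eventually.of_forall fun t => ?_)
  simp only [ContinuousMap.mul_apply, ← fourier_neg, smul_eq_mul]
  rw [neg_sub, sub_eq_add_neg, fourier_add]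
  ring

/-- The Hardy space `H²`, as a closed subspace of `L²(𝕋)`. -/
noncomputable def hardyTwo : Submodule ℂ CircleL2 :=
  (Submodule.span ℂ (Set.range fun k : ℕ => (fourierLp 2 (k : ℤ) : CircleL2))).topologicalClosure

/-- The space of complex conjugates of `H²` functions. -/
noncomputable def conjHardyTwo : Submodule ℂ CircleL2 :=
  (Submodule.span ℂ (Set.range fun k : ℕ => (fourierLp 2 (-k : ℤ) : CircleL2))).topologicalClosure

noncomputable instance : CompleteSpace hardyTwo :=
  (Submodule.isClosed_topologicalClosure _).completeSpace_coe

noncomputable instance : CompleteSpace conjHardyTwo :=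
  (Submodule.isClosed_topologicalClosure _).completeSpace_coe

theorem hardyTwo_le {V : Submodule ℂ CircleL2} (hV : IsClosed (V : Set CircleL2))
    (h : ∀ k : ℕ, fourierLp 2 (k : ℤ) ∈ V) : hardyTwo ≤ V :=
  Submodule.topologicalClosure_minimal _ (Submodule.span_le.2 (by rintro _ ⟨k, rfl⟩; exact h k)) hV

theorem conjHardyTwo_le {V : Submodule ℂ CircleL2} (hV : IsClosed (V : Set CircleL2))
    (h : ∀ k : ℕ, fourierLp 2 (-k : ℤ) ∈ V) : conjHardyTwo ≤ V :=
  Submodule.topologicalClosure_minimal _ (Submodule.span_le.2 (by rintro _ ⟨k, rfl⟩; exact h k)) hV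

theorem fourierLp_mem_hardyTwo (k : ℕ) : fourierLp 2 (k : ℤ) ∈ hardyTwo :=
  Submodule.le_topologicalClosure _ (Submodule.subset_span ⟨k, rfl⟩)

theorem fourierLp_mem_conjHardyTwo (k : ℕ) : fourierLp 2 (-k : ℤ) ∈ conjHardyTwo :=
  Submodule.le_topologicalClosure _ (Submodule.subset_span ⟨k, rfl⟩)

/-- The Hankel operator with a continuous symbol, as an operator on `L²(𝕋)`. -/
noncomputable def hankel : C(UCircle, ℂ) →L[ℂ] CircleL2 →L[ℂ] CircleL2 :=
  (ContinuousLinearMap.compL ℂ CircleL2 CircleL2 CircleL2 conjHardyTwo.starProjection).comp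
    (((ContinuousLinearMap.compL ℂ CircleL2 CircleL2 CircleL2).flip
      hardyTwo.starProjection).comp circleMulL)

theorem hankel_apply (F : C(UCircle, ℂ)) (f : CircleL2) :
    hankel F f = conjHardyTwo.starProjection (circleMulL F (hardyTwo.starProjection f)) := rfl

theorem norm_hankel_le (F : C(UCircle, ℂ)) : ‖hankel F‖ ≤ ‖F‖ := by
  refine ContinuousLinearMap.opNorm_le_bound _ (norm_nonneg _) fun f => ?_
  rw [hankel_apply]
  calc _ ≤ ‖circleMulL F (hardyTwo.starProjection f)‖ :=
        (ContinuousLinearMap.le_opNorm _ _).trans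
          (mul_le_of_le_one_left (norm_nonneg _) (Submodule.starProjection_norm_le _))
    _ ≤ ‖circleMulL F‖ * ‖hardyTwo.starProjection f‖ := ContinuousLinearMap.le_opNorm _ _
    _ ≤ ‖F‖ * ‖f‖ := by
        gcongr
        · exact norm_circleMulL_le F
        · exact (ContinuousLinearMap.le_opNorm _ _).trans
            (mul_le_of_le_one_left (norm_nonneg _) (Submodule.starProjection_norm_le _))

theorem inner_hankel {F : C(UCircle, ℂ)} {f g : CircleL2} (hf : f ∈ hardyTwo)
    (hg : g ∈ conjHardyTwo) : ⟪g, hankel F f⟫_ℂ = ⟪g, circleMulL F f⟫_ℂ := by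
  rw [hankel_apply, ← Submodule.inner_starProjection_left_eq_right,
    Submodule.starProjection_eq_self_iff.2 hf, Submodule.starProjection_eq_self_iff.2 hg]

theorem inner_fourierLp_of_ne {m n : ℤ} (h : m ≠ n) :
    ⟪(fourierLp 2 m : CircleL2), fourierLp 2 n⟫_ℂ = 0 :=
  orthonormal_fourier.2 h

/-- The span of the monomials `fourier j` for `m ≤ j ≤ 0` contains the range of the Hankel operator
with symbol `fourier m`. -/
theorem hankel_fourier_mem_span (m : ℤ) (f : CircleL2) :
    hankel (fourier m) f ∈ Submodule.span ℂ
      ((fun j : ℤ => (fourierLp 2 j : CircleL2)) '' Set.Icc m 0) := by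
  set V := Submodule.span ℂ ((fun j : ℤ => (fourierLp 2 j : CircleL2)) '' Set.Icc m 0) with hV
  have hfin : FiniteDimensional ℂ V :=
    FiniteDimensional.span_of_finite ℂ ((Set.finite_Icc m 0).image _)
  have hcl : IsClosed (V : Set CircleL2) := V.closed_of_finiteDimensional
  have hle : hardyTwo ≤ V.comap
      (conjHardyTwo.starProjection.comp (circleMulL (fourier m))).toLinearMap := by
    refine hardyTwo_le (hcl.preimage (ContinuousLinearMap.continuous _)) fun k => ?_
    rw [Submodule.mem_comap, ContinuousLinearMap.coe_coe, ContinuousLinearMap.comp_apply,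
      fourierLp, circleMulL_toL2]
    have h1 : (fourier m * fourier k : C(UCircle, ℂ)) = fourier (m + k) := by
      ext t; simp
    rw [h1]
    rcases le_or_gt (m + k) 0 with hk | hk
    · obtain ⟨j, hj⟩ := Int.eq_ofNat_of_zero_le (neg_nonneg.2 hk)
      have h2 : circleToL2 (fourier (m + k)) ∈ conjHardyTwo := by
        rw [← neg_neg (m + k : ℤ), hj]; exact fourierLp_mem_conjHardyTwo j
      rw [Submodule.starProjection_eq_self_iff.2 h2]
      exact Submodule.subset_span ⟨m + k, ⟨by omega, hk⟩, rfl⟩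
    · have h2 : circleToL2 (fourier (m + k)) ∈ conjHardyTwoᗮ := by
        have h3 : conjHardyTwo ≤ (Submodule.span ℂ {circleToL2 (fourier (m + k))})ᗮ := by
          refine conjHardyTwo_le (Submodule.isClosed_orthogonal _) fun j => ?_
          rw [Submodule.mem_orthogonal_singleton_iff_inner_right]
          exact inner_fourierLp_of_ne (by omega)
        rw [Submodule.mem_orthogonal]
        intro g hg
        have := h3 hg
        rwa [Submodule.mem_orthogonal_singleton_iff_inner_left] at this
      rw [(Submodule.starProjection_apply_eq_zero_iff _).2 h2]
      exact zero_mem V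
  have h := hle (Submodule.starProjection_apply_mem hardyTwo f)
  rwa [Submodule.mem_comap, ContinuousLinearMap.coe_coe, ContinuousLinearMap.comp_apply,
    ← hankel_apply] at h

/-- Symbols `fourier m` give finite rank operators, trigonometric polynomials are dense, and the
compact operators are closed. -/
theorem isCompactOperator_hankel (F : C(UCircle, ℂ)) : IsCompactOperator (hankel F) := by
  have hle : (⊤ : Submodule ℂ C(UCircle, ℂ)) ≤
      (compactOperator (RingHom.id ℂ) CircleL2 CircleL2).comap hankel.toLinearMap := by
    rw [← span_fourier_closure_eq_top]
    refine Submodule.topologicalClosure_minimal _ (Submodule.span_le.2 ?_)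
      (isClosed_setOfPred_isCompactOperator.preimage hankel.continuous)
    rintro _ ⟨m, rfl⟩
    set V := Submodule.span ℂ ((fun j : ℤ => (fourierLp 2 j : CircleL2)) '' Set.Icc m 0)
    have hfin : FiniteDimensional ℂ V :=
      FiniteDimensional.span_of_finite ℂ ((Set.finite_Icc m 0).image _)
    have : ProperSpace V := FiniteDimensional.proper ℂ V
    exact (isCompactOperator_of_locallyCompactSpace_rng V.subtypeL).comp_clm
      ((hankel (fourier m)).codRestrict V (hankel_fourier_mem_span m))
  exact hle (Submodule.mem_top (x := F))

/-- The matrix entries are the coefficients of F at -j - k with j, k ≥ 0. Constants lie in both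
Hardy spaces, so index 0 occurs, in agreement with the condition n ≤ 0 defining A₀. -/
theorem hankel_eq_zero_of_mem {F : C(UCircle, ℂ)} (hF : F ∈ discAlgebraZero) : hankel F = 0 := by
  ext1 f
  rw [hankel_apply, zero_apply, Submodule.starProjection_apply_eq_zero_iff]
  have hle : hardyTwo ≤ conjHardyTwoᗮ.comap (circleMulL F).toLinearMap := by
    refine hardyTwo_le ((Submodule.isClosed_orthogonal _).preimage (circleMulL F).continuous)
      fun k => ?_
    have h3 : conjHardyTwo ≤ (Submodule.span ℂ {circleMulL F (fourierLp 2 k)})ᗮ := by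
      refine conjHardyTwo_le (Submodule.isClosed_orthogonal _) fun j => ?_
      rw [Submodule.mem_orthogonal_singleton_iff_inner_left, inner_fourierLp_circleMulL]
      exact hF _ (by omega)
    rw [Submodule.mem_comap, ContinuousLinearMap.coe_coe, Submodule.mem_orthogonal]
    intro g hg
    have := h3 hg
    rwa [Submodule.mem_orthogonal_singleton_iff_inner_left] at this
  exact hle (Submodule.starProjection_apply_mem hardyTwo f)

theorem fourier_one_pow (k : ℕ) : (fourier 1 : C(UCircle, ℂ)) ^ k = fourier k := by
  ext t
  simp [fourier_apply, AddCircle.toCircle_nsmul]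

theorem circleToL2_mem_hardyTwo {u : C(UCircle, ℂ)} (hu : u ∈ discAlgebra) :
    circleToL2 u ∈ hardyTwo := by
  have hcl : IsClosed {u | circleToL2 u ∈ hardyTwo} :=
    (Submodule.isClosed_topologicalClosure _).preimage circleToL2.continuous
  refine closure_minimal (fun p hp => ?_) hcl hu
  rw [SetLike.mem_coe, Algebra.adjoin_singleton_eq_range_aeval] at hp
  obtain ⟨P, rfl⟩ := hp
  rw [AlgHom.toRingHom_eq_coe, RingHom.coe_coe, Polynomial.aeval_eq_sum_range]
  rw [Set.mem_ofPred_eq, map_sum]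
  refine sum_mem fun k _ => ?_
  rw [map_smul, fourier_one_pow]
  exact hardyTwo.smul_mem _ (fourierLp_mem_hardyTwo k)

theorem circleToL2_star_mem_conjHardyTwo {u : C(UCircle, ℂ)} (hu : u ∈ discAlgebra) :
    circleToL2 (star u) ∈ conjHardyTwo := by
  have hcl : IsClosed {u | circleToL2 (star u) ∈ conjHardyTwo} :=
    (Submodule.isClosed_topologicalClosure _).preimage (circleToL2.continuous.comp continuous_star)
  refine closure_minimal (fun p hp => ?_) hcl hu
  rw [SetLike.mem_coe, Algebra.adjoin_singleton_eq_range_aeval] at hp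
  obtain ⟨P, rfl⟩ := hp
  rw [AlgHom.toRingHom_eq_coe, RingHom.coe_coe, Polynomial.aeval_eq_sum_range]
  rw [Set.mem_ofPred_eq, star_sum, map_sum]
  refine sum_mem fun k _ => ?_
  rw [star_smul, map_smul, fourier_one_pow,
    show star (fourier k : C(UCircle, ℂ)) = fourier (-k) by ext t; rw [fourier_neg]; rfl]
  exact conjHardyTwo.smul_mem _ (fourierLp_mem_conjHardyTwo k)

theorem integrable_circle {E : Type*} [NormedAddCommGroup E] {f : UCircle → E}
    (hf : Continuous f) : Integrable f AddCircle.haarAddCircle :=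
  hf.integrable_of_hasCompactSupport (HasCompactSupport.of_compactSpace _)

theorem norm_circleToL2_sq (u : C(UCircle, ℂ)) :
    ‖circleToL2 u‖ ^ 2 = ∫ t, ‖u t‖ ^ 2 ∂AddCircle.haarAddCircle := by
  rw [← inner_self_eq_norm_sq (𝕜 := ℂ), ContinuousMap.inner_toLp]
  simp only [Complex.mul_conj, Complex.normSq_eq_norm_sq, integral_complex_ofReal,
    RCLike.re_eq_complex_re, Complex.ofReal_re]

theorem continuous_integral_circle {E : Type*} [NormedAddCommGroup E] [NormedSpace ℝ E] :
    Continuous fun f : C(UCircle, E) => ∫ t, f t ∂AddCircle.haarAddCircle := by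
  have h1 := (continuous_integral (μ := AddCircle.haarAddCircle (T := 2 * Real.pi)) (G := E)).comp
    (ContinuousMap.toLp 1 AddCircle.haarAddCircle ℝ).continuous
  refine h1.congr fun f => integral_congr_ae ?_
  exact ContinuousMap.coeFn_toLp (p := 1) (𝕜 := ℝ) AddCircle.haarAddCircle f

/-- For p = u v the integral is the pairing of v̄ with the Hankel operator applied to u. The balance
|u| = |v| makes Cauchy–Schwarz lossless: ‖u‖₂‖v‖₂ = ∫|p|. -/
theorem norm_integral_mul_le_of_mem_balancedProducts {p : C(UCircle, ℂ)}
    (hp : p ∈ balancedProducts) (F : C(UCircle, ℂ)) :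
    ‖∫ t, p t * F t ∂AddCircle.haarAddCircle‖ ≤
      ‖hankel F‖ * ∫ t, ‖p t‖ ∂AddCircle.haarAddCircle := by
  obtain ⟨u, hu, v, hv, rfl, huv⟩ := hp
  have h1 : ∫ t, (u * v) t * F t ∂AddCircle.haarAddCircle =
      ⟪circleToL2 (star v), hankel F (circleToL2 u)⟫_ℂ := by
    rw [inner_hankel (circleToL2_mem_hardyTwo hu) (circleToL2_star_mem_conjHardyTwo hv),
      circleMulL_toL2, ContinuousMap.inner_toLp]
    refine integral_congr_ae (Eventually.of_forall fun t => ?_)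
    simp
    ring
  have h2 : ‖circleToL2 (star v)‖ ^ 2 = ‖circleToL2 u‖ ^ 2 := by
    rw [norm_circleToL2_sq, norm_circleToL2_sq]
    simp [huv]
  have h3 : ‖circleToL2 (star v)‖ = ‖circleToL2 u‖ :=
    (sq_eq_sq₀ (norm_nonneg _) (norm_nonneg _)).1 h2
  have h4 : ∫ t, ‖(u * v) t‖ ∂AddCircle.haarAddCircle = ‖circleToL2 u‖ ^ 2 := by
    rw [norm_circleToL2_sq]
    refine integral_congr_ae (Eventually.of_forall fun t => ?_)
    simp [← huv t, sq]
  rw [h1, h4]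
  refine (norm_inner_le_norm _ _).trans ?_
  rw [h3, sq, ← mul_assoc, mul_comm]
  gcongr
  exact ContinuousLinearMap.le_opNorm _ _

theorem norm_integral_mul_le_norm_hankel {p : C(UCircle, ℂ)}
    (hp : p ∈ Algebra.adjoin ℂ {(fourier 1 : C(UCircle, ℂ))}) (F : C(UCircle, ℂ)) :
    ‖∫ t, p t * F t ∂AddCircle.haarAddCircle‖ ≤
      ‖hankel F‖ * ∫ t, ‖p t‖ ∂AddCircle.haarAddCircle := by
  have hcl : IsClosed {p : C(UCircle, ℂ) | ‖∫ t, p t * F t ∂AddCircle.haarAddCircle‖ ≤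
      ‖hankel F‖ * ∫ t, ‖p t‖ ∂AddCircle.haarAddCircle} := by
    refine isClosed_le (Continuous.norm ?_) (Continuous.mul continuous_const ?_)
    · exact continuous_integral_circle.comp (continuous_mul_const F)
    · exact continuous_integral_circle.comp
        (ContinuousMap.continuous_postcomp (⟨norm, continuous_norm⟩ : C(ℂ, ℝ)))
  exact closure_minimal (fun q hq => norm_integral_mul_le_of_mem_balancedProducts hq F) hcl
    (adjoin_fourier_one_subset_closure_balancedProducts hp)

end Hankel

/-! ### Fejér means, Nehari's theorem and the embedding of C(𝕋)/A₀. -/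

section Nehari

open MeasureTheory
open scoped InnerProductSpace ENNReal

/-- The `n`-th Fourier coefficient, as a functional on `C(𝕋)`. -/
noncomputable def fourierCoeffL (n : ℤ) : StrongDual ℂ C(UCircle, ℂ) :=
  (innerSL ℂ (fourierLp 2 n : CircleL2)).comp circleToL2

theorem fourierCoeffL_apply (n : ℤ) (g : C(UCircle, ℂ)) :
    fourierCoeffL n g = fourierCoeff (g : UCircle → ℂ) n := by
  have h := inner_fourierLp_circleMulL g n 0
  have h1 : g * fourier 0 = g := by ext t; simp
  rw [fourierLp, fourierLp, circleMulL_toL2, h1, sub_zero] at h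
  exact h

/-- The Fejér means of the Fourier series of a continuous function. -/
noncomputable def fejerMean (N : ℕ) : C(UCircle, ℂ) →L[ℂ] C(UCircle, ℂ) :=
  (N : ℂ)⁻¹ • ∑ j ∈ Finset.Ico (0 : ℤ) N, ∑ l ∈ Finset.Ico (0 : ℤ) N,
    (fourierCoeffL (j - l)).smulRight (fourier (j - l))

theorem fejerMean_apply (N : ℕ) (g : C(UCircle, ℂ)) :
    fejerMean N g = (N : ℂ)⁻¹ • ∑ j ∈ Finset.Ico (0 : ℤ) N, ∑ l ∈ Finset.Ico (0 : ℤ) N,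
      fourierCoeff (g : UCircle → ℂ) (j - l) • fourier (j - l) := by
  simp [fejerMean, fourierCoeffL_apply]

theorem norm_fejerMean_apply_le (N : ℕ) (g : C(UCircle, ℂ)) : ‖fejerMean N g‖ ≤ ‖g‖ := by
  rw [ContinuousMap.norm_le _ (norm_nonneg g)]
  intro s
  -- The Fejér mean at s is ⟨k, g k⟩ / N with ‖k‖² = N, so contractivity follows from that of
  -- multiplication by g on L².
  set k : CircleL2 := ∑ j ∈ Finset.Ico (0 : ℤ) N,
    (starRingEnd ℂ (fourier j s)) • (fourierLp 2 j : CircleL2) with hk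
  have h1 : ⟪k, circleMulL g k⟫_ℂ = ∑ j ∈ Finset.Ico (0 : ℤ) N, ∑ l ∈ Finset.Ico (0 : ℤ) N,
      fourierCoeff (g : UCircle → ℂ) (j - l) * fourier (j - l) s := by
    rw [hk, map_sum, sum_inner]
    refine Finset.sum_congr rfl fun j _ => ?_
    rw [inner_sum]
    refine Finset.sum_congr rfl fun l _ => ?_
    rw [map_smul, inner_smul_left, inner_smul_right, inner_fourierLp_circleMulL, sub_eq_add_neg,
      fourier_add, fourier_neg, Complex.conj_conj]
    ring
  have h2 : ⟪k, k⟫_ℂ = N := by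
    rw [hk, orthonormal_fourier.inner_sum]
    simp only [Complex.conj_conj, Complex.mul_conj, Complex.normSq_eq_norm_sq, norm_fourier_apply]
    simp
  have h3 : ‖k‖ ^ 2 = N := by
    rw [← inner_self_eq_norm_sq (𝕜 := ℂ), h2]
    simp
  have h4 : fejerMean N g s = (N : ℂ)⁻¹ * ⟪k, circleMulL g k⟫_ℂ := by
    rw [h1, fejerMean_apply]
    simp
  rw [h4, norm_mul, norm_inv, Complex.norm_natCast]
  calc (N : ℝ)⁻¹ * ‖⟪k, circleMulL g k⟫_ℂ‖ ≤ (N : ℝ)⁻¹ * (‖k‖ * (‖g‖ * ‖k‖)) := by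
        gcongr
        refine (norm_inner_le_norm _ _).trans ?_
        gcongr
        refine (ContinuousLinearMap.le_opNorm _ _).trans ?_
        gcongr
        exact norm_circleMulL_le g
    _ = (N : ℝ)⁻¹ * N * ‖g‖ := by rw [← h3]; ring
    _ ≤ ‖g‖ := mul_le_of_le_one_left (norm_nonneg g) (inv_mul_le_one)

/-- The factor N - |m| counts the pairs (j, l) in [0, N)² with j - l = m. -/
theorem fejerMean_fourier {N : ℕ} {m : ℤ} (hm : m.natAbs ≤ N) :
    fejerMean N (fourier m) = ((N : ℂ)⁻¹ * (N - m.natAbs)) • fourier m := by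
  have h1 : ∀ j ∈ Finset.Ico (0 : ℤ) N, (∑ l ∈ Finset.Ico (0 : ℤ) N,
      fourierCoeff (fourier m : UCircle → ℂ) (j - l) • (fourier (j - l) : C(UCircle, ℂ))) =
      if j ∈ Finset.Ico (max 0 m) (min N (N + m)) then fourier m else 0 := by
    intro j hj
    rw [fourierCoeff_fourier]
    have h2 : ∀ l : ℤ, (Pi.single m (1 : ℂ) : ℤ → ℂ) (j - l) •
        (fourier (j - l) : C(UCircle, ℂ)) = if l = j - m then fourier m else 0 := by
      intro l
      by_cases h : l = j - m
      · subst h; simp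
      · rw [if_neg h, Pi.single_eq_of_ne (by omega), zero_smul]
    simp_rw [h2]
    rw [Finset.sum_ite_eq']
    refine if_congr ?_ rfl rfl
    simp only [Finset.mem_Ico] at hj ⊢
    omega
  rw [fejerMean_apply, Finset.sum_congr rfl h1, ← Finset.sum_filter, Finset.sum_const, mul_smul]
  congr 1
  have h3 : (Finset.Ico (0 : ℤ) N).filter (· ∈ Finset.Ico (max 0 m) (min (N : ℤ) (N + m))) =
      Finset.Ico (max 0 m) (min (N : ℤ) (N + m)) := by
    ext j
    simp only [Finset.mem_filter, Finset.mem_Ico]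
    omega
  rw [h3, Int.card_Ico, ← Nat.cast_smul_eq_nsmul ℂ, ← Nat.cast_sub hm]
  congr 2
  omega

theorem tendsto_fejerMean_fourier (m : ℤ) :
    Tendsto (fun N => fejerMean N (fourier m)) atTop (𝓝 (fourier m)) := by
  have h1 : Tendsto (fun N : ℕ => (1 - m.natAbs * (N : ℂ)⁻¹) • (fourier m : C(UCircle, ℂ))) atTop
      (𝓝 (fourier m)) := by
    have h2 := (((tendsto_inv_atTop_nhds_zero_nat (𝕜 := ℂ)).const_mul
      (m.natAbs : ℂ)).const_sub 1).smul_const (fourier m : C(UCircle, ℂ))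
    simpa using h2
  refine h1.congr' ?_
  filter_upwards [eventually_ge_atTop (m.natAbs + 1)] with N hN
  rw [fejerMean_fourier (by omega)]
  have hN0 : (N : ℂ) ≠ 0 := Nat.cast_ne_zero.2 (by omega)
  congr 1
  field_simp

theorem tendsto_fejerMean_of_mem_span {F : C(UCircle, ℂ)}
    (hF : F ∈ Submodule.span ℂ (Set.range (fourier : ℤ → C(UCircle, ℂ)))) :
    Tendsto (fun N => fejerMean N F) atTop (𝓝 F) := by
  induction hF using Submodule.span_induction with
  | mem x hx => obtain ⟨m, rfl⟩ := hx; exact tendsto_fejerMean_fourier m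
  | zero => simp
  | add x y _ _ hx hy => simpa using hx.add hy
  | smul c x _ hx => simpa using hx.const_smul c

/-- The polynomial density of a functional composed with a Fejér mean. -/
noncomputable def fejerDensity (Φ : StrongDual ℂ C(UCircle, ℂ)) (N : ℕ) : C(UCircle, ℂ) :=
  (N : ℂ)⁻¹ • ∑ l ∈ Finset.Ico (0 : ℤ) N, ∑ j ∈ Finset.Ico (0 : ℤ) N,
    Φ (fourier (j - l)) • fourier (l - j)

theorem integral_fejerDensity_mul (Φ : StrongDual ℂ C(UCircle, ℂ)) (N : ℕ) (g : C(UCircle, ℂ)) :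
    ∫ t, fejerDensity Φ N t * g t ∂AddCircle.haarAddCircle = Φ (fejerMean N g) := by
  have h1 : ∀ p : C(UCircle, ℂ), ∫ t, p t * g t ∂AddCircle.haarAddCircle =
      ⟪circleToL2 (star g), circleToL2 p⟫_ℂ := fun p => by
    rw [ContinuousMap.inner_toLp]
    refine integral_congr_ae (Eventually.of_forall fun t => ?_)
    simp
  have h2 : ∀ j l : ℤ, ⟪circleToL2 (star g), circleToL2 (fourier (l - j))⟫_ℂ =
      fourierCoeff (g : UCircle → ℂ) (j - l) := fun j l => by
    rw [← h1, fourierCoeff, neg_sub]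
    rfl
  rw [h1, fejerDensity, fejerMean_apply, map_smul, inner_smul_right, map_smul, smul_eq_mul,
    Finset.sum_comm]
  congr 1
  simp only [map_sum, inner_sum, map_smul, inner_smul_right, h2, smul_eq_mul]
  exact Finset.sum_congr rfl fun _ _ => Finset.sum_congr rfl fun _ _ => mul_comm _ _

/-- Vanishing of Φ on positive frequencies leaves only terms with l - j ≥ 0, so the density is an
analytic polynomial and the factorization estimate applies to it. -/
theorem fejerDensity_mem_adjoin {Φ : StrongDual ℂ C(UCircle, ℂ)}
    (hΦ : ∀ n : ℤ, 0 < n → Φ (fourier n) = 0) (N : ℕ) :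
    fejerDensity Φ N ∈ Algebra.adjoin ℂ {(fourier 1 : C(UCircle, ℂ))} := by
  rw [fejerDensity]
  refine Subalgebra.smul_mem _ (sum_mem fun l _ => sum_mem fun j _ => ?_) _
  rcases lt_or_ge 0 (j - l) with h | h
  · rw [hΦ _ h, zero_smul]
    exact zero_mem _
  · obtain ⟨k, hk⟩ := Int.eq_ofNat_of_zero_le (show 0 ≤ l - j by omega)
    have h1 : (fourier 1 : C(UCircle, ℂ)) ^ k ∈
        Algebra.adjoin ℂ {(fourier 1 : C(UCircle, ℂ))} :=
      pow_mem (Algebra.subset_adjoin (Set.mem_singleton _)) k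
    rw [fourier_one_pow, ← hk] at h1
    exact Subalgebra.smul_mem _ h1 _

theorem integral_norm_le_one_of_forall_norm_integral_mul_le {p : C(UCircle, ℂ)}
    (hp : ∀ g : C(UCircle, ℂ), ‖∫ t, p t * g t ∂AddCircle.haarAddCircle‖ ≤ ‖g‖) :
    ∫ t, ‖p t‖ ∂AddCircle.haarAddCircle ≤ 1 := by
  refine le_of_forall_pos_le_add fun ε hε => ?_
  have hpos : ∀ t, 0 < ‖p t‖ + ε := fun t => add_pos_of_nonneg_of_pos (norm_nonneg _) hε
  -- A continuous substitute for the conjugate sign of p; ε > 0 avoids division by zero at the zeros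
  -- of p.
  let g : C(UCircle, ℂ) := ⟨fun t => starRingEnd ℂ (p t) * (((‖p t‖ + ε)⁻¹ : ℝ) : ℂ), by
    refine (Complex.continuous_conj.comp p.continuous).mul (Complex.continuous_ofReal.comp ?_)
    exact (p.continuous.norm.add continuous_const).inv₀ fun t => (hpos t).ne'⟩
  have hg : ‖g‖ ≤ 1 := by
    rw [ContinuousMap.norm_le _ zero_le_one]
    intro t
    change ‖starRingEnd ℂ (p t) * (((‖p t‖ + ε)⁻¹ : ℝ) : ℂ)‖ ≤ 1
    rw [norm_mul, RCLike.norm_conj, Complex.norm_real, Real.norm_of_nonneg (inv_pos.2 (hpos t)).le,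
      ← div_eq_mul_inv, div_le_one (hpos t)]
    linarith
  have h1 : ∫ t, p t * g t ∂AddCircle.haarAddCircle =
      ((∫ t, ‖p t‖ ^ 2 * (‖p t‖ + ε)⁻¹ ∂AddCircle.haarAddCircle : ℝ) : ℂ) := by
    rw [← integral_complex_ofReal]
    refine integral_congr_ae (Eventually.of_forall fun t => ?_)
    change p t * (starRingEnd ℂ (p t) * (((‖p t‖ + ε)⁻¹ : ℝ) : ℂ)) = _
    rw [← mul_assoc, Complex.mul_conj, Complex.normSq_eq_norm_sq]
    push_cast
    rfl
  have h2 : ∫ t, ‖p t‖ ^ 2 * (‖p t‖ + ε)⁻¹ ∂AddCircle.haarAddCircle ≤ 1 := by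
    have h3 := (hp g).trans hg
    rw [h1, Complex.norm_real] at h3
    exact (le_abs_self _).trans h3
  have hcont : Continuous fun t => ‖p t‖ ^ 2 * (‖p t‖ + ε)⁻¹ :=
    (p.continuous.norm.pow 2).mul
      ((p.continuous.norm.add continuous_const).inv₀ fun t => (hpos t).ne')
  have h4 : ∫ t, ‖p t‖ ∂AddCircle.haarAddCircle ≤
      ∫ t, (‖p t‖ ^ 2 * (‖p t‖ + ε)⁻¹ + ε) ∂AddCircle.haarAddCircle := by
    refine integral_mono (integrable_circle p.continuous.norm)
      (integrable_circle (hcont.add continuous_const)) fun t => ?_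
    simp only
    rw [← div_eq_mul_inv, div_add' _ _ _ (hpos t).ne', le_div_iff₀ (hpos t)]
    nlinarith [sq_nonneg ε]
  rw [integral_add (integrable_circle hcont) (integrable_const _), integral_const] at h4
  simp only [probReal_univ, one_smul] at h4
  linarith

/-- The main estimate in Nehari's theorem: a functional of norm one on `C(𝕋)` that annihilates
`A₀` is bounded by the norm of the Hankel operator. -/
theorem norm_apply_le_norm_hankel {Φ : StrongDual ℂ C(UCircle, ℂ)} (hΦ1 : ‖Φ‖ ≤ 1)
    (hΦ : ∀ n : ℤ, 0 < n → Φ (fourier n) = 0) (F : C(UCircle, ℂ)) : ‖Φ F‖ ≤ ‖hankel F‖ := by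
  have hle : ∀ g, ‖Φ g‖ ≤ ‖g‖ := fun g =>
    (Φ.le_opNorm g).trans (mul_le_of_le_one_left (norm_nonneg g) hΦ1)
  have hdens : ∀ N, ∫ t, ‖fejerDensity Φ N t‖ ∂AddCircle.haarAddCircle ≤ 1 := fun N =>
    integral_norm_le_one_of_forall_norm_integral_mul_le fun g => by
      rw [integral_fejerDensity_mul]
      exact (hle _).trans (norm_fejerMean_apply_le N g)
  -- Φ of the N-th Fejér mean of G is the integral of G against an analytic polynomial of L¹ norm at
  -- most 1; then N → ∞.
  have hspan : ∀ G ∈ Submodule.span ℂ (Set.range (fourier : ℤ → C(UCircle, ℂ))),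
      ‖Φ G‖ ≤ ‖hankel G‖ := fun G hG => by
    refine le_of_tendsto ((Φ.continuous.tendsto G).comp (tendsto_fejerMean_of_mem_span hG)).norm
      (Eventually.of_forall fun N => ?_)
    rw [Function.comp_apply, ← integral_fejerDensity_mul]
    exact (norm_integral_mul_le_norm_hankel (fejerDensity_mem_adjoin hΦ N) G).trans
      (mul_le_of_le_one_right (norm_nonneg _) (hdens N))
  have hcl : IsClosed {G : C(UCircle, ℂ) | ‖Φ G‖ ≤ ‖hankel G‖} :=
    isClosed_le Φ.continuous.norm hankel.continuous.norm
  have hF : F ∈ (Submodule.span ℂ (Set.range (fourier : ℤ → C(UCircle, ℂ)))).topologicalClosure := by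
    rw [span_fourier_closure_eq_top]; exact Submodule.mem_top
  exact closure_minimal hspan hcl hF

theorem fourier_mem_discAlgebraZero {n : ℤ} (hn : 0 < n) : fourier n ∈ discAlgebraZero := by
  intro m hm
  rw [fourierCoeff_fourier, Pi.single_eq_of_ne (by omega)]

/-- Nehari's theorem for continuous symbols. -/
theorem norm_hankel_eq (F : C(UCircle, ℂ)) : ‖hankel F‖ = ‖discAlgebraZero.mkQ F‖ := by
  refine le_antisymm (le_of_forall_pos_le_add fun ε hε => ?_) ?_
  · obtain ⟨G, hG, hlt⟩ := Submodule.Quotient.norm_mk_lt (discAlgebraZero.mkQ F) hε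
    have h1 : hankel F = hankel G := by
      have h2 := hankel_eq_zero_of_mem ((Submodule.Quotient.eq _).1 hG)
      rw [map_sub, sub_eq_zero] at h2
      exact h2.symm
    rw [h1]
    exact (norm_hankel_le G).trans hlt.le
  -- A functional norming the class of F lifts to one on C(𝕋) that annihilates A₀, which is the
  -- setting of the main estimate.
  · obtain ⟨φ, hφ1, hφ2⟩ := exists_dual_vector'' ℂ (discAlgebraZero.mkQ F)
    have h1 := norm_apply_le_norm_hankel (Φ := φ.comp discAlgebraZero.mkQL)
      (ContinuousLinearMap.opNorm_le_bound _ zero_le_one fun g => by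
        calc ‖φ (discAlgebraZero.mkQ g)‖ ≤ ‖φ‖ * ‖discAlgebraZero.mkQ g‖ := φ.le_opNorm _
          _ ≤ 1 * ‖g‖ := by
            gcongr
            exact Submodule.Quotient.norm_mk_le _ g)
      (fun n hn => by
        have : discAlgebraZero.mkQ (fourier n) = 0 :=
          (Submodule.Quotient.mk_eq_zero _).2 (fourier_mem_discAlgebraZero hn)
        rw [ContinuousLinearMap.comp_apply, Submodule.mkQL_apply, this, map_zero]) F
    rw [ContinuousLinearMap.comp_apply, Submodule.mkQL_apply, hφ2] at h1
    simpa using h1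

/-- The isometric embedding of `C(𝕋) / A₀` into the compact operators on `L²(𝕋)` by Hankel
operators. -/
noncomputable def hankelLI : (C(UCircle, ℂ) ⧸ discAlgebraZero) →ₗᵢ[ℂ]
    compactOperator (RingHom.id ℂ) CircleL2 CircleL2 where
  toLinearMap := discAlgebraZero.liftQ
    (hankel.toLinearMap.codRestrict (compactOperator (RingHom.id ℂ) CircleL2 CircleL2)
      isCompactOperator_hankel)
    (fun _ hF => Subtype.ext (hankel_eq_zero_of_mem hF))
  norm_map' x := by
    obtain ⟨F, rfl⟩ := discAlgebraZero.mkQ_surjective x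
    rw [← norm_hankel_eq]
    rfl

end Nehari

theorem mainTheorem1 :
    (∀ (𝕜 : Type*) [RCLike 𝕜] (X : Type*) [NormedAddCommGroup X] [NormedSpace 𝕜 X]
        [CompleteSpace X],
        WeakStarSeqCompactDualBall 𝕜 X → DualHasWeakStarUKK 𝕜 X → HasWeakFPP 𝕜 X) ∧
    (∀ (𝕜 : Type*) [RCLike 𝕜], HasWeakFPP 𝕜 C₀(ℕ, 𝕜)) ∧
    HasWeakFPP ℂ (C(UCircle, ℂ) ⧸ discAlgebraZero) ∧
    (∀ (𝕜 : Type*) [RCLike 𝕜] (H : Type*) [NormedAddCommGroup H] [InnerProductSpace 𝕜 H]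
        [CompleteSpace H], HasWeakFPP 𝕜 (compactOperator (RingHom.id 𝕜) H H)) := by
  refine ⟨fun 𝕜 _ X _ _ _ hc hk => (weakNullSumBound_of_dualHasWeakStarUKK hc hk).hasWeakFPP,
    fun 𝕜 _ => weakNullSumBound_zeroAtInfty.hasWeakFPP,
    (weakNullSumBound_compactOperator.of_linearIsometry hankelLI).hasWeakFPP,
    fun 𝕜 _ H _ _ _ => weakNullSumBound_compactOperator.hasWeakFPP⟩
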